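/- Let $\mathbb{C}^3$ carry the standard holomorphic Riemannian metric, i.e. the complex bilinear form $g(X,Y)=X_1Y_1+X_2Y_2+X_3Y_3$, and let $D$ be its flat connection. Let $M$ be a connected complex surface (a complex manifold of complex dimension 2), and let $f:M\to\mathbb{C}^3$ be a holomorphic immersion for which the metric induced by $g$ on $M$ is non-degenerate; for instance, $f$ may be the inclusion of a complex submanifold with non-degenerate induced metric. For local holomorphic vector fields $X,Y$ on $M$ and local holomorphic normal fields $\xi$ along $f$, let $\nabla_XY=(D_XY)^\top$, $h(X,Y)=(D_XY)^\bot$ and $\nabla^\bot_X\xi=(D_X\xi)^\bot$ be the induced connection, the second fundamental form and the normal connection, where $\top$ and $\bot$ denote the tangential and the $g$-orthogonal normal components. Suppose that $M$ is parallel, i.e. $\nabla h=0$: for all local holomorphic vector fields $X,Y,Z$ on $M$, $$\nabla^\bot_X\big(h(Y,Z)\big)-h(\nabla_XY,Z)-h(Y,\nabla_XZ)=0 .$$ Then the surface $f(M)$ is similar to an open part of one of the following four surfaces in $\mathbb{C}^3$; that is, there are $\alpha\in\mathbb{C}\setminus\{0\}$, $A\in \mathrm{O}(3,\mathbb{C})$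 and $b\in\mathbb{C}^3$ such that the similarity $z\mapsto \alpha Az+b$ maps $f(M)$ onto a relatively open subset of one of them. 1. The complex plane $\{z_3=0\}$. 2. The complex sphere $\mathbb{C}S^2=\{z_1^2+z_2^2+z_3^2=1\}$. 3. The cylinder $\mathbb{C}S^1\times\mathbb{C}=\{z_1^2+z_2^2=1\}$. 4. The surface $B=\{z_3=(z_1+iz_2)^2\}$. -/

import Mathlib

open scoped Manifold ContDiff

namespace HolRiem

/-- The standard holomorphic inner product `z₁ w₁ + z₂ w₂ + z₃ w₃` on `ℂ³`: complex bilinear,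
with no complex conjugation. -/
def g (z w : Fin 3 → ℂ) : ℂ := z ⬝ᵥ w

section Surface

variable {M : Type*} [TopologicalSpace M] [ChartedSpace (Fin 2 → ℂ) M]

/-- The flat derivative `D_X V` at `p` of a `ℂ³`-valued map `V` on the surface, in the direction
of the tangent vector `x` at `p`. -/
noncomputable def D (V : M → Fin 3 → ℂ) (p : M) (x : TangentSpace 𝓘(ℂ, Fin 2 → ℂ) p) :
    Fin 3 → ℂ :=
  mfderiv 𝓘(ℂ, Fin 2 → ℂ) 𝓘(ℂ, Fin 3 → ℂ) V p x

/-- `f : M → ℂ³` is a holomorphic Riemannian immersion of the complex surface `M`: it is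
holomorphic, its differential is injective at every point, and the holomorphic metric induced on
every tangent space is non-degenerate. -/
structure IsHolRiemImmersion (f : M → Fin 3 → ℂ) : Prop where
  holomorphic : ContMDiff 𝓘(ℂ, Fin 2 → ℂ) 𝓘(ℂ, Fin 3 → ℂ) ω f
  immersion : ∀ p : M, Function.Injective (D f p)
  nondegenerate : ∀ (p : M) (x : TangentSpace 𝓘(ℂ, Fin 2 → ℂ) p),
    (∀ y : TangentSpace 𝓘(ℂ, Fin 2 → ℂ) p, g (D f p x) (D f p y) = 0) → x = 0

/-- `x` is the tangential component at `p` of the vector `v` of `ℂ³`, that is, `v - df(x)` is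
orthogonal to the tangent plane `df(T_p M)`. -/
def IsTangentPart (f : M → Fin 3 → ℂ) (p : M) (v : Fin 3 → ℂ)
    (x : TangentSpace 𝓘(ℂ, Fin 2 → ℂ) p) : Prop :=
  ∀ y : TangentSpace 𝓘(ℂ, Fin 2 → ℂ) p, g (v - D f p x) (D f p y) = 0

/-- The tangential component exists and is unique when the induced metric is non-degenerate. -/
theorem IsHolRiemImmersion.existsUnique_isTangentPart {f : M → Fin 3 → ℂ}
    (hf : IsHolRiemImmersion f) (p : M) (v : Fin 3 → ℂ) : ∃! x, IsTangentPart f p v x := by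
  let d : (Fin 2 → ℂ) →ₗ[ℂ] (Fin 3 → ℂ) :=
    (mfderiv 𝓘(ℂ, Fin 2 → ℂ) 𝓘(ℂ, Fin 3 → ℂ) f p : (Fin 2 → ℂ) →L[ℂ] (Fin 3 → ℂ)).toLinearMap
  let B : (Fin 3 → ℂ) →ₗ[ℂ] (Fin 2 → ℂ) →ₗ[ℂ] ℂ :=
    (dotProductBilin ℂ ℂ).compl₂ d
  have hB : ∀ w y, B w y = g w (D f p y) := fun w y => rfl
  have hinj : Function.Injective (B ∘ₗ d) := by
    rw [← LinearMap.ker_eq_bot, LinearMap.ker_eq_bot']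
    intro x hx
    exact hf.nondegenerate p x fun y => by
      have := LinearMap.congr_fun hx y
      exact this
  have hsurj : Function.Surjective (B ∘ₗ d) :=
    (LinearMap.injective_iff_surjective_of_finrank_eq_finrank
      (Subspace.dual_finrank_eq (K := ℂ) (V := Fin 2 → ℂ)).symm).1 hinj
  have key : ∀ x : Fin 2 → ℂ, IsTangentPart f p v x ↔ (B ∘ₗ d) x = B v := by
    intro x
    have e : ∀ y, B (v - d x) y = B v y - (B ∘ₗ d) x y := fun y => by simp [B]
    constructor
    · intro h
      refine LinearMap.ext fun y => ?_
      exact (sub_eq_zero.1 ((e y).symm.trans (h y))).symm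
    · intro h y
      exact (e y).trans (sub_eq_zero.2 (LinearMap.congr_fun h y).symm)
  obtain ⟨x, hx⟩ := hsurj (B v)
  exact ⟨x, (key x).2 hx, fun y hy => hinj (((key y).1 hy).trans hx.symm)⟩

open Classical in
/-- The tangential component of `v` at `p`, as a tangent vector of the surface (and `0` in the
degenerate case in which it is not defined). -/
noncomputable def tangentPart (f : M → Fin 3 → ℂ) (p : M) (v : Fin 3 → ℂ) :
    TangentSpace 𝓘(ℂ, Fin 2 → ℂ) p :=
  if h : ∃ x, IsTangentPart f p v x then h.choose else 0

theorem IsHolRiemImmersion.isTangentPart_tangentPart {f : M → Fin 3 → ℂ}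
    (hf : IsHolRiemImmersion f) (p : M) (v : Fin 3 → ℂ) :
    IsTangentPart f p v (tangentPart f p v) := by
  have h := (hf.existsUnique_isTangentPart p v).exists
  rw [tangentPart, dif_pos h]
  exact h.choose_spec

/-- The normal component `v^⊥ = v - v^⊤` of `v` at `p`. -/
noncomputable def normalPart (f : M → Fin 3 → ℂ) (p : M) (v : Fin 3 → ℂ) : Fin 3 → ℂ :=
  v - D f p (tangentPart f p v)

/-- The second fundamental form `h(X, Y) = (D_X Y)^⊥`, the tangent field `Y` being viewed as the
`ℂ³`-valued map `df(Y)`. -/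
noncomputable def secondFF (f : M → Fin 3 → ℂ) (X Y : ∀ p : M, TangentSpace 𝓘(ℂ, Fin 2 → ℂ) p)
    (p : M) : Fin 3 → ℂ :=
  normalPart f p (D (fun q => D f q (Y q)) p (X p))

/-- The induced connection `∇_X Y = (D_X Y)^⊤`. -/
noncomputable def nabla (f : M → Fin 3 → ℂ) (X Y : ∀ p : M, TangentSpace 𝓘(ℂ, Fin 2 → ℂ) p)
    (p : M) : TangentSpace 𝓘(ℂ, Fin 2 → ℂ) p :=
  tangentPart f p (D (fun q => D f q (Y q)) p (X p))

/-- The normal connection `∇^⊥_X ξ = (D_X ξ)^⊥`. -/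
noncomputable def nablaPerp (f : M → Fin 3 → ℂ) (X : ∀ p : M, TangentSpace 𝓘(ℂ, Fin 2 → ℂ) p)
    (ξ : M → Fin 3 → ℂ) (p : M) : Fin 3 → ℂ :=
  normalPart f p (D ξ p (X p))

/-- The covariant derivative of the second fundamental form,
`(∇_X h)(Y, Z) = ∇^⊥_X (h(Y, Z)) - h(∇_X Y, Z) - h(Y, ∇_X Z)`. -/
noncomputable def nablaSecondFF (f : M → Fin 3 → ℂ)
    (X Y Z : ∀ p : M, TangentSpace 𝓘(ℂ, Fin 2 → ℂ) p) (p : M) : Fin 3 → ℂ :=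
  nablaPerp f X (secondFF f Y Z) p - secondFF f (nabla f X Y) Z p - secondFF f Y (nabla f X Z) p

/-- `X` is a holomorphic vector field on the set `U`. -/
def IsHolVectorFieldOn [IsManifold 𝓘(ℂ, Fin 2 → ℂ) ω M]
    (X : ∀ p : M, TangentSpace 𝓘(ℂ, Fin 2 → ℂ) p) (U : Set M) : Prop :=
  ContMDiffOn 𝓘(ℂ, Fin 2 → ℂ) 𝓘(ℂ, Fin 2 → ℂ).tangent ω
    (fun p => (⟨p, X p⟩ : TangentBundle 𝓘(ℂ, Fin 2 → ℂ) M)) U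

/-- The second fundamental form of `f` is parallel, `∇h = 0`: the expression `(∇_X h)(Y, Z)`
vanishes on `U` for all holomorphic vector fields `X`, `Y`, `Z` on an open set `U` of `M`. -/
def IsParallel [IsManifold 𝓘(ℂ, Fin 2 → ℂ) ω M] (f : M → Fin 3 → ℂ) : Prop :=
  ∀ (U : Set M) (X Y Z : ∀ p : M, TangentSpace 𝓘(ℂ, Fin 2 → ℂ) p), IsOpen U →
    IsHolVectorFieldOn X U → IsHolVectorFieldOn Y U → IsHolVectorFieldOn Z U →
      ∀ p ∈ U, nablaSecondFF f X Y Z p = 0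

end Surface

/-- Similarities of `ℂ³`: compositions `z ↦ α A z + b` of complex orthogonal transformations,
dilations by a nonzero complex number, and translations. -/
def IsSimilarity (φ : (Fin 3 → ℂ) → Fin 3 → ℂ) : Prop :=
  ∃ (α : ℂ) (A : Matrix (Fin 3) (Fin 3) ℂ) (b : Fin 3 → ℂ),
    α ≠ 0 ∧ A.transpose * A = 1 ∧ ∀ z, φ z = α • A.mulVec z + b

/-- The set `N` is similar to an open part of `S`: some similarity maps it onto a relatively open
subset of `S`. -/
def IsSimilarToOpenPart (N S : Set (Fin 3 → ℂ)) : Prop :=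
  ∃ φ : (Fin 3 → ℂ) → Fin 3 → ℂ, IsSimilarity φ ∧
    ∃ O : Set (Fin 3 → ℂ), IsOpen O ∧ φ '' N = S ∩ O

/-- The complex plane `z₃ = 0`. -/
def complexPlane : Set (Fin 3 → ℂ) := {z | z 2 = 0}

/-- The complex unit sphere `z₁² + z₂² + z₃² = 1`. -/
def complexSphere : Set (Fin 3 → ℂ) := {z | z 0 ^ 2 + z 1 ^ 2 + z 2 ^ 2 = 1}

/-- The cylinder `z₁² + z₂² = 1`. -/
def complexCylinder : Set (Fin 3 → ℂ) := {z | z 0 ^ 2 + z 1 ^ 2 = 1}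

/-- The surface `z₃ = (z₁ + i z₂)²`. -/
def surfaceB : Set (Fin 3 → ℂ) := {z | z 2 = (z 0 + Complex.I * z 1) ^ 2}

end HolRiem

/-!
In a chart, let `F` be the immersion and `n` a holomorphic unit normal, which exists locally because
the induced metric is non-degenerate. The equation `∇h = 0` says that the tangential part of `∂ₓ∂ᵧn`
is dual to `F` in the sense that `g(∂ₓ∂ᵧn, ∂_zF) = g(∂ₓ∂ᵧF, ∂_zn)`
(`IsUnitNormalOn.g_second_normal_dd`). Differentiating once more and using that second derivatives
commute, all terms with Christoffel symbols cancel, and what remains is the proportionality of the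
third fundamental form `g(∂ₓn, ∂ᵧn)` to the second one (`IsUnitNormalOn.second_mul_third`). The ratio
`μ` is constant, since both forms are parallel (`IsUnitNormalOn.exists_proportional`).

Hence the shape operator `S` satisfies `S² = μ S`. Extend it to an endomorphism `C` of `ℂ³` by
`C n = μ n`. The structure equations show that `C`, as a matrix, does not depend on the point
(`IsUnitNormalOn.dd_extendedShape`). So `dn = -C dF` integrates: the unit normal is the affine function
`n = n₀ - C (F - z₀)` of the position, and the surface lies in the quadric
`2 g(z - z₀, n₀) = g(z - z₀, C (z - z₀))` (`IsUnitNormalOn.exists_parallelQuadric`), where `C` is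
symmetric, `C² = μ C` and `C n₀ = μ n₀`. By the identity theorem the whole of `f(M)` lies in this
quadric, and by the inverse function theorem it is open there
(`ParallelQuadric.eventually_mem_image`).

It remains to bring `C` to normal form. On `n₀^⊥` it is a symmetric `2 × 2` matrix `T` with `T² = μ T`:
either `T = 0`, and then also `μ = 0` (plane), or `T = μ` with `μ ≠ 0` (sphere), or `T` has rank one
and trace `μ ≠ 0` (cylinder), or `T ≠ 0` and `μ = 0`, so that `T` is nilpotent (the surface `B`); see
`ParallelQuadric.exists_isSimilarity`.
-/

namespace HolRiem

/-! ### The bilinear form -/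

theorem g_comm (z w : Fin 3 → ℂ) : g z w = g w z := dotProduct_comm z w

theorem g_add_left (z z' w : Fin 3 → ℂ) : g (z + z') w = g z w + g z' w := add_dotProduct z z' w

theorem g_add_right (z w w' : Fin 3 → ℂ) : g z (w + w') = g z w + g z w' := dotProduct_add z w w'

theorem g_sub_left (z z' w : Fin 3 → ℂ) : g (z - z') w = g z w - g z' w := sub_dotProduct z z' w

theorem g_sub_right (z w w' : Fin 3 → ℂ) : g z (w - w') = g z w - g z w' := dotProduct_sub z w w'

theorem g_smul_left (a : ℂ) (z w : Fin 3 → ℂ) : g (a • z) w = a * g z w := smul_dotProduct a z w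

theorem g_smul_right (a : ℂ) (z w : Fin 3 → ℂ) : g z (a • w) = a * g z w := dotProduct_smul a z w

theorem g_neg_left (z w : Fin 3 → ℂ) : g (-z) w = -g z w := neg_dotProduct z w

theorem g_neg_right (z w : Fin 3 → ℂ) : g z (-w) = -g z w := dotProduct_neg z w

theorem g_zero_left (w : Fin 3 → ℂ) : g 0 w = 0 := zero_dotProduct w

/-- `g` as a continuous bilinear map. -/
noncomputable def gL : (Fin 3 → ℂ) →L[ℂ] (Fin 3 → ℂ) →L[ℂ] ℂ :=
  (dotProductBilin ℂ ℂ).toContinuousBilinearMap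

theorem gL_apply (z w : Fin 3 → ℂ) : gL z w = g z w := rfl

/-! ### Directional derivatives of maps on open sets of `ℂ²` -/

section Calculus

variable {W : Type*} [NormedAddCommGroup W] [NormedSpace ℂ W]

/-- The derivative of a map on `ℂ²` in a constant direction `x`, as a map on `ℂ²`. -/
noncomputable def dd (x : Fin 2 → ℂ) (u : (Fin 2 → ℂ) → W) : (Fin 2 → ℂ) → W :=
  fun q => fderiv ℂ u q x

theorem dd_apply (x : Fin 2 → ℂ) (u : (Fin 2 → ℂ) → W) (q : Fin 2 → ℂ) :
    dd x u q = fderiv ℂ u q x := rfl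

variable {u v : (Fin 2 → ℂ) → Fin 3 → ℂ} {q : Fin 2 → ℂ}

theorem analyticAt_dd [CompleteSpace W] {u : (Fin 2 → ℂ) → W} (hu : AnalyticAt ℂ u q)
    (x : Fin 2 → ℂ) : AnalyticAt ℂ (dd x u) q :=
  ((ContinuousLinearMap.apply ℂ W x).analyticAt _).comp hu.fderiv

theorem dd_comm [CompleteSpace W] {u : (Fin 2 → ℂ) → W} (hu : AnalyticAt ℂ u q)
    (x y : Fin 2 → ℂ) : dd x (dd y u) q = dd y (dd x u) q := by
  have key : ∀ x y, dd x (dd y u) q = fderiv ℂ (fderiv ℂ u) q x y := fun x y => by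
    have h := (((ContinuousLinearMap.apply ℂ W y).hasFDerivAt (x := fderiv ℂ u q)).comp q
      hu.fderiv.differentiableAt.hasFDerivAt).fderiv
    exact congrArg (fun T => T x) h
  rw [key, key]
  exact (hu.contDiffAt (n := ω)).isSymmSndFDerivAt_of_omega x y

theorem analyticAt_g (hu : AnalyticAt ℂ u q) (hv : AnalyticAt ℂ v q) :
    AnalyticAt ℂ (fun r => g (u r) (v r)) q :=
  (gL.analyticAt_bilinear (u q, v q)).comp_of_eq (hu.prod hv) rfl

theorem dd_g (hu : DifferentiableAt ℂ u q) (hv : DifferentiableAt ℂ v q) (x : Fin 2 → ℂ) :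
    dd x (fun r => g (u r) (v r)) q = g (dd x u q) (v q) + g (u q) (dd x v q) := by
  have h := (gL.hasFDerivAt_of_bilinear hu.hasFDerivAt hv.hasFDerivAt).fderiv
  have h' := congrArg (fun T => T x) h
  refine h'.trans ?_
  simp [gL_apply, dd, add_comm]

theorem dd_congr {u v : (Fin 2 → ℂ) → W} (h : u =ᶠ[nhds q] v) (x : Fin 2 → ℂ) :
    dd x u q = dd x v q := by
  rw [dd, dd, h.fderiv_eq]

theorem dd_sub {u v : (Fin 2 → ℂ) → W} (hu : DifferentiableAt ℂ u q)
    (hv : DifferentiableAt ℂ v q) (x : Fin 2 → ℂ) :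
    dd x (fun r => u r - v r) q = dd x u q - dd x v q := by
  simp only [dd, fderiv_fun_sub hu hv, sub_apply]

theorem dd_smul {a : (Fin 2 → ℂ) → ℂ} {v : (Fin 2 → ℂ) → W} (ha : DifferentiableAt ℂ a q)
    (hv : DifferentiableAt ℂ v q) (x : Fin 2 → ℂ) :
    dd x (fun r => a r • v r) q = a q • dd x v q + dd x a q • v q := by
  simp only [dd, fderiv_fun_smul ha hv]
  simp

theorem dd_const (c : W) (x : Fin 2 → ℂ) : dd x (fun _ => c) q = 0 := by
  simp [dd]

end Calculus

/-! ### Unit normal fields -/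

/-- `n` is a holomorphic unit normal field of the immersion `F` on the open set `U` of `ℂ²`. -/
structure IsUnitNormalOn (F n : (Fin 2 → ℂ) → Fin 3 → ℂ) (U : Set (Fin 2 → ℂ)) : Prop where
  isOpen : IsOpen U
  analytic : AnalyticOnNhd ℂ F U
  analytic_normal : AnalyticOnNhd ℂ n U
  injective : ∀ q ∈ U, Function.Injective (fderiv ℂ F q)
  unit : ∀ q ∈ U, g (n q) (n q) = 1
  orthogonal : ∀ q ∈ U, ∀ x, g (fderiv ℂ F q x) (n q) = 0

/-- The equation `∇h = 0` for constant vector fields, in terms of a unit normal `n`. -/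
def IsParallelOn (F n : (Fin 2 → ℂ) → Fin 3 → ℂ) (U : Set (Fin 2 → ℂ)) : Prop :=
  ∀ q ∈ U, ∀ x y z : Fin 2 → ℂ,
    dd x (fun r => g (dd y (dd z F) r) (n r)) q + g (dd x (dd y F) q) (dd z n q)
      + g (dd x (dd z F) q) (dd y n q) = 0

theorem IsUnitNormalOn.g_dd_normal_normal {F n : (Fin 2 → ℂ) → Fin 3 → ℂ} {U : Set (Fin 2 → ℂ)}
    (h : IsUnitNormalOn F n U) {q : Fin 2 → ℂ} (hq : q ∈ U) (x : Fin 2 → ℂ) :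
    g (dd x n q) (n q) = 0 := by
  have an := h.analytic_normal q hq
  have h1 : (fun r => g (n r) (n r)) =ᶠ[nhds q] fun _ => 1 := by
    filter_upwards [h.isOpen.mem_nhds hq] with r hr using h.unit r hr
  have h2 := dd_congr h1 x
  rw [dd_const, dd_g an.differentiableAt an.differentiableAt, g_comm (n q)] at h2
  exact self_eq_neg.1 (eq_neg_of_add_eq_zero_left h2)

section Frame

variable {L : (Fin 2 → ℂ) →L[ℂ] Fin 3 → ℂ} {n : Fin 3 → ℂ}

/-- A unit normal and a tangent plane span `ℂ³`: the normal is not tangent because it is not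
null. -/
theorem exists_eq_tangent_add_normal (hL : Function.Injective L) (hn : g n n = 1)
    (ho : ∀ x, g (L x) n = 0) (v : Fin 3 → ℂ) : ∃ x, v = L x + g v n • n := by
  let Φ : (Fin 2 → ℂ) × ℂ →ₗ[ℂ] Fin 3 → ℂ :=
    L.toLinearMap.coprod (LinearMap.toSpanSingleton ℂ _ n)
  have hΦ : ∀ x t, Φ (x, t) = L x + t • n := fun x t => by simp [Φ]
  have hg : ∀ x t, g (Φ (x, t)) n = t := fun x t => by
    rw [hΦ, g_add_left, ho, g_smul_left, hn, zero_add, mul_one]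
  have hinj : Function.Injective Φ := by
    rw [← LinearMap.ker_eq_bot, LinearMap.ker_eq_bot']
    rintro ⟨x, t⟩ h
    have ht : t = 0 := by rw [← hg x t, h, g_zero_left]
    subst ht
    rw [hΦ, zero_smul, add_zero] at h
    rw [hL (h.trans (map_zero L).symm)]
    rfl
  have hsurj : Function.Surjective Φ :=
    (LinearMap.injective_iff_surjective_of_finrank_eq_finrank (by simp)).1 hinj
  obtain ⟨⟨x, t⟩, rfl⟩ := hsurj v
  exact ⟨x, by rw [hg, hΦ]⟩

theorem eq_zero_of_orthogonal_frame (hL : Function.Injective L) (hn : g n n = 1)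
    (ho : ∀ x, g (L x) n = 0) {w : Fin 3 → ℂ} (h : ∀ x, g w (L x) = 0) (h' : g w n = 0) :
    w = 0 := by
  refine dotProduct_eq_zero w fun v => ?_
  obtain ⟨x, hx⟩ := exists_eq_tangent_add_normal hL hn ho v
  change g w v = 0
  rw [hx, g_add_right, h, g_smul_right, h', mul_zero, add_zero]

end Frame

/-! ### The surface in a chart -/

section Chart

variable {M : Type*} [TopologicalSpace M] [ChartedSpace (Fin 2 → ℂ) M]

theorem IsHolRiemImmersion.normalPart_eq {f : M → Fin 3 → ℂ}
    (hf : IsHolRiemImmersion f) {p : M} {n : Fin 3 → ℂ} (hn : g n n = 1)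
    (ho : ∀ x, g (D f p x) n = 0) (v : Fin 3 → ℂ) : normalPart f p v = g v n • n := by
  have ht := hf.isTangentPart_tangentPart p v
  set x := tangentPart f p v with hx
  have e : g (v - D f p x) n = g v n := by rw [g_sub_left, ho, sub_zero]
  have h0 : v - D f p x - g v n • n = 0 := by
    refine eq_zero_of_orthogonal_frame
      (L := mfderiv 𝓘(ℂ, Fin 2 → ℂ) 𝓘(ℂ, Fin 3 → ℂ) f p) (hf.immersion p) hn ho
      (fun y => ?_) ?_
    · have h1 := ht y
      have h2 := ho y
      rw [g_comm] at h2
      rw [g_sub_left, g_smul_left]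
      refine (congrArg₂ (fun a b => a - g v n * b) h1 h2).trans ?_
      simp
    · rw [g_sub_left, g_smul_left, e, hn, mul_one, sub_self]
  rw [normalPart, ← hx]
  exact sub_eq_zero.1 h0

/-- The map `f` read in the preferred chart at `p₀`. -/
noncomputable def inChart (f : M → Fin 3 → ℂ) (p₀ : M) : (Fin 2 → ℂ) → Fin 3 → ℂ :=
  f ∘ (chartAt (Fin 2 → ℂ) p₀).symm

theorem eventuallyEq_inChart (p₀ : M) (f : M → Fin 3 → ℂ) {p : M}
    (hp : p ∈ (chartAt (Fin 2 → ℂ) p₀).source) :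
    f =ᶠ[nhds p] inChart f p₀ ∘ chartAt (Fin 2 → ℂ) p₀ := by
  filter_upwards [(chartAt (Fin 2 → ℂ) p₀).open_source.mem_nhds hp] with q hq
  simp [inChart, (chartAt (Fin 2 → ℂ) p₀).left_inv hq]

variable [IsManifold 𝓘(ℂ, Fin 2 → ℂ) ω M]

/-- The vector field with constant coefficients `c` in the preferred chart at `p₀`, on the domain of
this chart (and `0` outside). -/
noncomputable def coordField (p₀ : M) (c : Fin 2 → ℂ) (p : M) :
    TangentSpace 𝓘(ℂ, Fin 2 → ℂ) p :=
  (trivializationAt (Fin 2 → ℂ) (TangentSpace 𝓘(ℂ, Fin 2 → ℂ)) p₀).symmL ℂ p c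

theorem isHolVectorFieldOn_coordField (p₀ : M) (c : Fin 2 → ℂ) :
    IsHolVectorFieldOn (coordField p₀ c) (chartAt (Fin 2 → ℂ) p₀).source := by
  set t := trivializationAt (Fin 2 → ℂ) (TangentSpace 𝓘(ℂ, Fin 2 → ℂ) : M → Type _) p₀
  have : ContMDiffVectorBundle ω (Fin 2 → ℂ) (TangentSpace 𝓘(ℂ, Fin 2 → ℂ) : M → Type _)
    𝓘(ℂ, Fin 2 → ℂ) := inferInstance
  have h := (Bundle.Trivialization.contMDiffOn_symm (IB := 𝓘(ℂ, Fin 2 → ℂ)) (n := ω) t)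
  have h2 : ContMDiffOn 𝓘(ℂ, Fin 2 → ℂ) (𝓘(ℂ, Fin 2 → ℂ).prod 𝓘(ℂ, Fin 2 → ℂ)) ω
      (fun p : M => (p, c)) (chartAt (Fin 2 → ℂ) p₀).source :=
    contMDiffOn_id.prodMk contMDiffOn_const
  refine (h.comp h2 ?_).congr ?_
  · intro p hp
    exact t.mem_target.2 hp
  · intro p hp
    rw [Function.comp, ← t.mk_symm (by exact hp), coordField, ← t.symmL_apply (R := ℂ) (by exact hp)]

variable (p₀ : M) {p : M}

theorem mfderiv_chart_coordField (c : Fin 2 → ℂ)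
    (hp : p ∈ (chartAt (Fin 2 → ℂ) p₀).source) :
    mfderiv 𝓘(ℂ, Fin 2 → ℂ) 𝓘(ℂ, Fin 2 → ℂ) (chartAt (Fin 2 → ℂ) p₀) p (coordField p₀ c p) = c := by
  have h := TangentBundle.continuousLinearMapAt_trivializationAt (I := 𝓘(ℂ, Fin 2 → ℂ)) hp
  have h' := Bundle.Trivialization.continuousLinearMapAt_symmL (R := ℂ)
    (trivializationAt (Fin 2 → ℂ) (TangentSpace 𝓘(ℂ, Fin 2 → ℂ) : M → Type _) p₀)
    (b := p) hp c
  rw [h, show ⇑(extChartAt 𝓘(ℂ, Fin 2 → ℂ) p₀) = chartAt (Fin 2 → ℂ) p₀ by simp [mfld_simps]] at h'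
  exact h'

theorem exists_coordField_eq (hp : p ∈ (chartAt (Fin 2 → ℂ) p₀).source)
    (x : TangentSpace 𝓘(ℂ, Fin 2 → ℂ) p) : ∃ c, coordField p₀ c p = x :=
  ⟨_, Bundle.Trivialization.symmL_continuousLinearMapAt (R := ℂ)
    (trivializationAt (Fin 2 → ℂ) (TangentSpace 𝓘(ℂ, Fin 2 → ℂ) : M → Type _) p₀)
    (b := p) hp x⟩

/-- The flat derivative of a map given near `p` by `u` in the chart at `p₀`. -/
theorem D_coordField {V : M → Fin 3 → ℂ} {u : (Fin 2 → ℂ) → Fin 3 → ℂ}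
    (hp : p ∈ (chartAt (Fin 2 → ℂ) p₀).source)
    (hu : DifferentiableAt ℂ u (chartAt (Fin 2 → ℂ) p₀ p))
    (hV : V =ᶠ[nhds p] u ∘ chartAt (Fin 2 → ℂ) p₀) (c : Fin 2 → ℂ) :
    D V p (coordField p₀ c p) = dd c u (chartAt (Fin 2 → ℂ) p₀ p) := by
  have he : MDifferentiableAt 𝓘(ℂ, Fin 2 → ℂ) 𝓘(ℂ, Fin 2 → ℂ) (chartAt (Fin 2 → ℂ) p₀) p :=
    mdifferentiableAt_atlas (chart_mem_atlas _ _) hp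
  have h := mfderiv_comp p hu.mdifferentiableAt he
  rw [D, hV.mfderiv_eq, h, mfderiv_eq_fderiv, dd]
  exact congrArg (fderiv ℂ u _) (mfderiv_chart_coordField p₀ c hp)

theorem IsHolRiemImmersion.analyticOnNhd_inChart {f : M → Fin 3 → ℂ}
    (hf : IsHolRiemImmersion f) :
    AnalyticOnNhd ℂ (inChart f p₀) (chartAt (Fin 2 → ℂ) p₀).target := by
  have h : ContMDiffOn 𝓘(ℂ, Fin 2 → ℂ) 𝓘(ℂ, Fin 3 → ℂ) ω (inChart f p₀)
      (chartAt (Fin 2 → ℂ) p₀).target :=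
    hf.holomorphic.comp_contMDiffOn contMDiffOn_chart_symm
  rw [contMDiffOn_iff_contDiffOn] at h
  intro q hq
  exact (h.contDiffAt ((chartAt (Fin 2 → ℂ) p₀).open_target.mem_nhds hq)).analyticAt

theorem IsHolRiemImmersion.D_coordField_eq {f : M → Fin 3 → ℂ} (hf : IsHolRiemImmersion f)
    (hp : p ∈ (chartAt (Fin 2 → ℂ) p₀).source) (c : Fin 2 → ℂ) :
    D f p (coordField p₀ c p) = dd c (inChart f p₀) (chartAt (Fin 2 → ℂ) p₀ p) :=
  D_coordField p₀ hp
    (hf.analyticOnNhd_inChart p₀ _ ((chartAt (Fin 2 → ℂ) p₀).map_source hp)).differentiableAt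
    (eventuallyEq_inChart p₀ f hp) c

theorem IsHolRiemImmersion.injective_fderiv_inChart {f : M → Fin 3 → ℂ}
    (hf : IsHolRiemImmersion f) {q : Fin 2 → ℂ} (hq : q ∈ (chartAt (Fin 2 → ℂ) p₀).target) :
    Function.Injective (fderiv ℂ (inChart f p₀) q) := by
  intro x y hxy
  have hp := (chartAt (Fin 2 → ℂ) p₀).map_target hq
  have key := fun c => hf.D_coordField_eq p₀ hp c
  rw [(chartAt (Fin 2 → ℂ) p₀).right_inv hq] at key
  have h := hf.immersion _ ((key x).trans (hxy.trans (key y).symm))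
  rw [← mfderiv_chart_coordField p₀ x hp, h, mfderiv_chart_coordField p₀ y hp]

theorem IsHolRiemImmersion.nondegenerate_inChart {f : M → Fin 3 → ℂ}
    (hf : IsHolRiemImmersion f) {q : Fin 2 → ℂ} (hq : q ∈ (chartAt (Fin 2 → ℂ) p₀).target)
    {x : Fin 2 → ℂ} (h : ∀ y, g (dd x (inChart f p₀) q) (dd y (inChart f p₀) q) = 0) :
    x = 0 := by
  have hp := (chartAt (Fin 2 → ℂ) p₀).map_target hq
  have key := fun c => hf.D_coordField_eq p₀ hp c
  rw [(chartAt (Fin 2 → ℂ) p₀).right_inv hq] at key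
  have h0 : coordField p₀ x ((chartAt (Fin 2 → ℂ) p₀).symm q) = 0 := by
    refine hf.nondegenerate _ _ fun y => ?_
    obtain ⟨c, rfl⟩ := exists_coordField_eq p₀ hp y
    rw [key, key]
    exact h c
  rw [← mfderiv_chart_coordField p₀ x hp, h0]
  exact map_zero _

/-- For constant coordinate fields the invariant equation `∇h = 0` becomes the equation of
`IsParallelOn` for any unit normal. -/
theorem IsParallel.isParallelOn {f : M → Fin 3 → ℂ} (hf : IsHolRiemImmersion f)
    (hpar : IsParallel f) {n : (Fin 2 → ℂ) → Fin 3 → ℂ} {U : Set (Fin 2 → ℂ)}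
    (hU : U ⊆ (chartAt (Fin 2 → ℂ) p₀).target) (hn : IsUnitNormalOn (inChart f p₀) n U) :
    IsParallelOn (inChart f p₀) n U := by
  set e := chartAt (Fin 2 → ℂ) p₀ with he
  set F := inChart f p₀ with hF
  have hOp : IsOpen (e.source ∩ e ⁻¹' U) := e.isOpen_inter_preimage hn.isOpen
  -- the points of `M` at which `n` is a unit normal
  have hnorm : ∀ p ∈ e.source ∩ e ⁻¹' U, ∀ v, normalPart f p v = g v (n (e p)) • n (e p) := by
    rintro p ⟨hp, hpU⟩ v
    refine hf.normalPart_eq (hn.unit _ hpU) (fun x => ?_) v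
    obtain ⟨c, rfl⟩ := exists_coordField_eq p₀ hp x
    rw [hf.D_coordField_eq p₀ hp]
    exact hn.orthogonal _ hpU _
  have hFan : ∀ r ∈ U, AnalyticAt ℂ F r := hn.analytic
  have hD : ∀ p ∈ e.source ∩ e ⁻¹' U, ∀ z, (fun q => D f q (coordField p₀ z q)) =ᶠ[nhds p]
      dd z F ∘ e := by
    rintro p ⟨hp, hpU⟩ z
    filter_upwards [e.open_source.mem_nhds hp] with q hq
    exact hf.D_coordField_eq p₀ hq z
  have hDD : ∀ p ∈ e.source ∩ e ⁻¹' U, ∀ c z,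
      D (fun q => D f q (coordField p₀ z q)) p (coordField p₀ c p) = dd c (dd z F) (e p) := by
    intro p hp c z
    exact D_coordField p₀ hp.1 (analyticAt_dd (hFan _ hp.2) z).differentiableAt (hD p hp z) c
  have hff : ∀ p ∈ e.source ∩ e ⁻¹' U, ∀ c z, secondFF f (coordField p₀ c) (coordField p₀ z) p =
      g (dd c (dd z F) (e p)) (n (e p)) • n (e p) := by
    intro p hp c z
    rw [secondFF, hDD p hp, hnorm p hp]
  have htan : ∀ p ∈ e.source ∩ e ⁻¹' U, ∀ v, D f p (tangentPart f p v) =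
      v - g v (n (e p)) • n (e p) := by
    intro p hp v
    rw [← hnorm p hp, normalPart, sub_sub_cancel]
  intro q hq x y z
  set p := e.symm q with hpdef
  have hep : e p = q := e.right_inv (hU hq)
  have hp : p ∈ e.source ∩ e ⁻¹' U := ⟨e.map_target (hU hq), by rw [Set.mem_preimage, hep]; exact hq⟩
  have hpar' := hpar e.source (coordField p₀ x) (coordField p₀ y) (coordField p₀ z) e.open_source
    (isHolVectorFieldOn_coordField p₀ x) (isHolVectorFieldOn_coordField p₀ y)
    (isHolVectorFieldOn_coordField p₀ z) p hp.1
  have aF := hFan q hq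
  have an := hn.analytic_normal q hq
  have daF : ∀ c c', AnalyticAt ℂ (dd c (dd c' F)) q := fun c c' =>
    analyticAt_dd (analyticAt_dd aF c') c
  have hb : ∀ c c', AnalyticAt ℂ (fun r => g (dd c (dd c' F) r) (n r)) q := fun c c' =>
    analyticAt_g (daF c c') an
  have hUq : ∀ᶠ r in nhds q, r ∈ U := hn.isOpen.mem_nhds hq
  have hnn := hn.g_dd_normal_normal hq
  -- `∇^⊥_X (h(Y, Z))`
  have T1 : nablaPerp f (coordField p₀ x) (secondFF f (coordField p₀ y) (coordField p₀ z)) p =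
      dd x (fun r => g (dd y (dd z F) r) (n r)) q • n q := by
    have hξ : secondFF f (coordField p₀ y) (coordField p₀ z) =ᶠ[nhds p]
        (fun r => g (dd y (dd z F) r) (n r) • n r) ∘ e := by
      filter_upwards [hOp.mem_nhds hp] with p' hp' using hff p' hp' y z
    have hdiff : DifferentiableAt ℂ (fun r => g (dd y (dd z F) r) (n r) • n r) (e p) := by
      rw [hep]; exact (hb y z).differentiableAt.smul an.differentiableAt
    rw [nablaPerp, D_coordField p₀ hp.1 hdiff hξ, hnorm p hp, ← he, hep,
      dd_smul (hb y z).differentiableAt an.differentiableAt, g_add_left, g_smul_left, g_smul_left,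
      hnn, hn.unit q hq]
    simp
  -- `h(∇_X Y, Z)`: only the value of `∇_X Y` at `p` matters, so a coordinate field replaces it
  have T2 : secondFF f (nabla f (coordField p₀ x) (coordField p₀ y)) (coordField p₀ z) p =
      -g (dd x (dd y F) q) (dd z n q) • n q := by
    obtain ⟨w, hw⟩ := exists_coordField_eq p₀ hp.1 (nabla f (coordField p₀ x) (coordField p₀ y) p)
    have h1 : secondFF f (nabla f (coordField p₀ x) (coordField p₀ y)) (coordField p₀ z) p =
        secondFF f (coordField p₀ w) (coordField p₀ z) p := by
      rw [secondFF, secondFF, hw]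
    have h2 : dd w F q = dd x (dd y F) q - g (dd x (dd y F) q) (n q) • n q := by
      have := htan p hp (D (fun q => D f q (coordField p₀ y q)) p (coordField p₀ x p))
      have h3 := hf.D_coordField_eq p₀ hp.1 w
      rw [hw, ← he, hep, nabla, this, hDD p hp, hep] at h3
      exact h3.symm
    have h4 : (fun r => g (dd w F r) (n r)) =ᶠ[nhds q] fun _ => 0 := by
      filter_upwards [hUq] with r hr using hn.orthogonal r hr w
    have h5 := dd_congr h4 z
    rw [dd_const, dd_g (analyticAt_dd aF w).differentiableAt an.differentiableAt, h2, g_sub_left,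
      g_smul_left, g_comm (n q), hnn, mul_zero, sub_zero, ← dd_comm aF] at h5
    rw [h1, hff p hp, hep, eq_neg_of_add_eq_zero_left h5]
  -- `h(Y, ∇_X Z)`: the field `df(∇_X Z)` is `∂ₓ∂_zF` minus its normal component
  have T3 : secondFF f (coordField p₀ y) (nabla f (coordField p₀ x) (coordField p₀ z)) p =
      -g (dd x (dd z F) q) (dd y n q) • n q := by
    have hY : (fun q => D f q (nabla f (coordField p₀ x) (coordField p₀ z) q)) =ᶠ[nhds p]
        (fun r => dd x (dd z F) r - g (dd x (dd z F) r) (n r) • n r) ∘ e := by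
      filter_upwards [hOp.mem_nhds hp] with p' hp'
      rw [nabla, htan p' hp', hDD p' hp']
      rfl
    have hbn : DifferentiableAt ℂ (fun r => g (dd x (dd z F) r) (n r) • n r) q :=
      (hb x z).differentiableAt.smul an.differentiableAt
    have hdiff : DifferentiableAt ℂ
        (fun r => dd x (dd z F) r - g (dd x (dd z F) r) (n r) • n r) (e p) := by
      rw [hep]; exact (daF x z).differentiableAt.sub hbn
    rw [secondFF, D_coordField p₀ hp.1 hdiff hY, hnorm p hp, ← he, hep,
      dd_sub (daF x z).differentiableAt hbn,
      dd_smul (hb x z).differentiableAt an.differentiableAt,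
      dd_g (daF x z).differentiableAt an.differentiableAt, g_sub_left, g_add_left, g_smul_left,
      g_smul_left, hnn, hn.unit q hq]
    congr 1
    ring
  rw [nablaSecondFF, T1, T2, T3, ← sub_smul, ← sub_smul] at hpar'
  have h6 := congrArg (fun v => g v (n q)) hpar'
  simp only [g_smul_left, hn.unit q hq, g_zero_left, mul_one] at h6
  linear_combination h6

end Chart

/-! ### The structure equations of a parallel surface -/

namespace IsUnitNormalOn

variable {F n : (Fin 2 → ℂ) → Fin 3 → ℂ} {U : Set (Fin 2 → ℂ)} {q : Fin 2 → ℂ}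

theorem mono (h : IsUnitNormalOn F n U) {V : Set (Fin 2 → ℂ)} (hV : IsOpen V) (hVU : V ⊆ U) :
    IsUnitNormalOn F n V :=
  ⟨hV, h.analytic.mono hVU, h.analytic_normal.mono hVU, fun q hq => h.injective q (hVU hq),
    fun q hq => h.unit q (hVU hq), fun q hq => h.orthogonal q (hVU hq)⟩

theorem eq_zero (h : IsUnitNormalOn F n U) (hq : q ∈ U) {w : Fin 3 → ℂ}
    (h1 : ∀ x, g w (dd x F q) = 0) (h2 : g w (n q) = 0) : w = 0 :=
  eq_zero_of_orthogonal_frame (h.injective q hq) (h.unit q hq) (h.orthogonal q hq) h1 h2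

theorem exists_eq_add (h : IsUnitNormalOn F n U) (hq : q ∈ U) (v : Fin 3 → ℂ) :
    ∃ x, v = dd x F q + g v (n q) • n q :=
  exists_eq_tangent_add_normal (h.injective q hq) (h.unit q hq) (h.orthogonal q hq) v

theorem g_dd_normal (h : IsUnitNormalOn F n U) (hq : q ∈ U) (x : Fin 2 → ℂ) :
    g (dd x F q) (n q) = 0 := h.orthogonal q hq x

theorem exists_dd_normal_eq (h : IsUnitNormalOn F n U) (hq : q ∈ U) (x : Fin 2 → ℂ) :
    ∃ w, dd x n q = dd w F q := by
  obtain ⟨w, hw⟩ := h.exists_eq_add hq (dd x n q)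
  exact ⟨w, by rw [hw, h.g_dd_normal_normal hq, zero_smul, add_zero]⟩

theorem g_second (h : IsUnitNormalOn F n U) (hq : q ∈ U) (x y : Fin 2 → ℂ) :
    g (dd y (dd x F) q) (n q) = -g (dd x F q) (dd y n q) := by
  have h1 : (fun r => g (dd x F r) (n r)) =ᶠ[nhds q] fun _ => 0 := by
    filter_upwards [h.isOpen.mem_nhds hq] with r hr using h.orthogonal r hr x
  have h2 := dd_congr h1 y
  rw [dd_const, dd_g (analyticAt_dd (h.analytic q hq) x).differentiableAt
    (h.analytic_normal q hq).differentiableAt] at h2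
  exact eq_neg_of_add_eq_zero_left h2

/-- The shape operator is symmetric. -/
theorem g_dd_dd_normal_comm (h : IsUnitNormalOn F n U) (hq : q ∈ U) (x y : Fin 2 → ℂ) :
    g (dd x F q) (dd y n q) = g (dd y F q) (dd x n q) := by
  rw [← neg_inj, ← h.g_second hq, ← h.g_second hq, dd_comm (h.analytic q hq)]

theorem g_second_normal (h : IsUnitNormalOn F n U) (hq : q ∈ U) (x y : Fin 2 → ℂ) :
    g (dd y (dd x n) q) (n q) = -g (dd x n q) (dd y n q) := by
  have h1 : (fun r => g (dd x n r) (n r)) =ᶠ[nhds q] fun _ => 0 := by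
    filter_upwards [h.isOpen.mem_nhds hq] with r hr using h.g_dd_normal_normal hr x
  have h2 := dd_congr h1 y
  rw [dd_const, dd_g (analyticAt_dd (h.analytic_normal q hq) x).differentiableAt
    (h.analytic_normal q hq).differentiableAt] at h2
  exact eq_neg_of_add_eq_zero_left h2

/-- For a parallel surface the tangential part of `∂ₓ∂ᵧn` is determined by the shape operator. -/
theorem g_second_normal_dd (h : IsUnitNormalOn F n U) (hpar : IsParallelOn F n U) (hq : q ∈ U)
    (x y z : Fin 2 → ℂ) :
    g (dd x (dd y n) q) (dd z F q) = g (dd x (dd y F) q) (dd z n q) := by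
  have aF := h.analytic q hq
  have an := h.analytic_normal q hq
  have h1 : (fun r => g (dd y (dd z F) r) (n r)) =ᶠ[nhds q]
      fun r => -g (dd z F r) (dd y n r) := by
    filter_upwards [h.isOpen.mem_nhds hq] with r hr using h.g_second hr z y
  have h2 := dd_congr h1 x
  have h3 : dd x (fun r => -g (dd z F r) (dd y n r)) q =
      -dd x (fun r => g (dd z F r) (dd y n r)) q := by
    simp only [dd_apply x, fderiv_fun_neg, neg_apply]
  rw [h3, dd_g (analyticAt_dd aF z).differentiableAt (analyticAt_dd an y).differentiableAt] at h2
  rw [g_comm]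
  linear_combination h2 - hpar q hq x y z

/-- In the difference of the two mixed products of second derivatives the products of tangential
parts (the Christoffel terms) cancel; the products of normal parts remain. -/
theorem g_second_mixed (h : IsUnitNormalOn F n U) (hpar : IsParallelOn F n U) (hq : q ∈ U)
    (x y z w : Fin 2 → ℂ) :
    g (dd x (dd y n) q) (dd z (dd w F) q) - g (dd x (dd y F) q) (dd z (dd w n) q) =
      g (dd x (dd y F) q) (n q) * g (dd w n q) (dd z n q)
        - g (dd z (dd w F) q) (n q) * g (dd y n q) (dd x n q) := by
  have key : ∀ x y z w s t, dd x (dd y F) q = dd s F q + g (dd x (dd y F) q) (n q) • n q →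
      dd z (dd w F) q = dd t F q + g (dd z (dd w F) q) (n q) • n q →
      g (dd x (dd y n) q) (dd z (dd w F) q) =
        g (dd s F q) (dd t n q) - g (dd z (dd w F) q) (n q) * g (dd y n q) (dd x n q) := by
    intro x y z w s t hs ht
    conv_lhs => rw [ht]
    rw [g_add_right, g_smul_right, h.g_second_normal hq, h.g_second_normal_dd hpar hq]
    conv_lhs => rw [hs]
    rw [g_add_left, g_smul_left, g_comm (n q) (dd t n q), h.g_dd_normal_normal hq]
    ring
  obtain ⟨s, hs⟩ := h.exists_eq_add hq (dd x (dd y F) q)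
  obtain ⟨t, ht⟩ := h.exists_eq_add hq (dd z (dd w F) q)
  rw [g_comm (dd x (dd y F) q) (dd z (dd w n) q), key x y z w s t hs ht, key z w x y t s ht hs,
    h.g_dd_dd_normal_comm hq s t]
  ring

/-- **Integrability of `∇h = 0`.** The second fundamental form `g(∂ₓ∂ᵧF, n)` and the third
fundamental form `g(∂ₓn, ∂ᵧn)` of a parallel surface are proportional at every point. -/
theorem second_mul_third (h : IsUnitNormalOn F n U) (hpar : IsParallelOn F n U) (hq : q ∈ U)
    (x y z w : Fin 2 → ℂ) :
    g (dd x (dd y F) q) (n q) * g (dd z n q) (dd w n q) =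
      g (dd z (dd w F) q) (n q) * g (dd x n q) (dd y n q) := by
  have aF := h.analytic q hq
  have an := h.analytic_normal q hq
  -- derive `g_second_normal_dd` in the direction `w` and use that `∂_w` and `∂ₓ` commute
  have O : ∀ w x y z, g (dd w (dd z F) q) (n q) * g (dd x n q) (dd y n q)
      - g (dd x (dd y F) q) (n q) * g (dd w n q) (dd z n q) =
      g (dd x (dd z F) q) (n q) * g (dd w n q) (dd y n q)
      - g (dd w (dd y F) q) (n q) * g (dd x n q) (dd z n q) := by
    have D : ∀ w x y z, g (dd w (dd x (dd y n)) q) (dd z F q)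
        - g (dd w (dd x (dd y F)) q) (dd z n q) =
        g (dd w (dd z F) q) (n q) * g (dd x n q) (dd y n q)
        - g (dd x (dd y F) q) (n q) * g (dd w n q) (dd z n q) := by
      intro w x y z
      have h1 : (fun r => g (dd x (dd y n) r) (dd z F r)) =ᶠ[nhds q]
          fun r => g (dd x (dd y F) r) (dd z n r) := by
        filter_upwards [h.isOpen.mem_nhds hq] with r hr using h.g_second_normal_dd hpar hr x y z
      have h2 := dd_congr h1 w
      rw [dd_g (analyticAt_dd (analyticAt_dd an y) x).differentiableAt
          (analyticAt_dd aF z).differentiableAt,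
        dd_g (analyticAt_dd (analyticAt_dd aF y) x).differentiableAt
          (analyticAt_dd an z).differentiableAt] at h2
      have h3 := h.g_second_mixed hpar hq x y w z
      rw [g_comm (dd y n q), g_comm (dd z n q)] at h3
      linear_combination h2 - h3
    intro w x y z
    rw [← D w x y z, ← D x w y z, dd_comm (analyticAt_dd an y), dd_comm (analyticAt_dd aF y)]
  -- with `b` and `c` for the two forms, `O` says that `b(w, z) c(x, y) - b(x, y) c(w, z)` is
  -- invariant under `w ↔ x`; hence it is also invariant under `z ↔ y`, and as the two together change
  -- its sign, it vanishes
  have h1 := O x z w y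
  have h2 := O y w z x
  rw [dd_comm aF y x, dd_comm aF w z, g_comm (dd w n q) (dd z n q), g_comm (dd y n q) (dd x n q),
    dd_comm aF w x, dd_comm aF y z, g_comm (dd w n q) (dd x n q), g_comm (dd y n q) (dd z n q)] at h2
  linear_combination (h1 + h2) / 2

section Proportional

variable {μ : ℂ}

/-- If the third fundamental form is `μ` times the second, then the shape operator acts as `μ` on
its image. -/
theorem dd_normal_of_proportional (h : IsUnitNormalOn F n U) (hq : q ∈ U)
    (hμ : ∀ x y, g (dd x n q) (dd y n q) = μ * g (dd x (dd y F) q) (n q)) {y w : Fin 2 → ℂ}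
    (hw : dd y n q = dd w F q) : dd w n q = -μ • dd w F q := by
  rw [← sub_eq_zero]
  refine h.eq_zero hq (fun z => ?_) ?_
  · rw [g_sub_left, g_smul_left, g_comm, h.g_dd_dd_normal_comm hq, ← hw, hμ, h.g_second hq,
      g_comm (dd y n q)]
    ring
  · rw [g_sub_left, g_smul_left, h.g_dd_normal_normal hq, h.g_dd_normal hq]
    ring

/-- Both forms are parallel, with the same Christoffel terms, so if they are proportional at a point
then so are their derivatives there. -/
theorem dd_third (h : IsUnitNormalOn F n U) (hpar : IsParallelOn F n U) (hq : q ∈ U)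
    (hμ : ∀ x y, g (dd x n q) (dd y n q) = μ * g (dd x (dd y F) q) (n q)) (x y z : Fin 2 → ℂ) :
    dd y (fun r => g (dd x n r) (dd z n r)) q =
      μ * dd y (fun r => g (dd x (dd z F) r) (n r)) q := by
  have an := h.analytic_normal q hq
  have key : ∀ x z, g (dd y (dd x n) q) (dd z n q) = -μ * g (dd y (dd x F) q) (dd z n q) := by
    intro x z
    obtain ⟨w, hw⟩ := h.exists_dd_normal_eq hq z
    rw [hw, h.g_second_normal_dd hpar hq, h.dd_normal_of_proportional hq hμ hw, g_smul_right]
  rw [dd_g (analyticAt_dd an x).differentiableAt (analyticAt_dd an z).differentiableAt, key,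
    g_comm (dd x n q) (dd y (dd z n) q), key]
  linear_combination -μ * hpar q hq y x z

/-- The second derivatives of `F` and of `n` correspond under the linear map that sends `∂ₓF` to
`-∂ₓn` and `n` to `μ n`. -/
theorem dd_dd_normal_of_proportional (h : IsUnitNormalOn F n U) (hpar : IsParallelOn F n U)
    (hq : q ∈ U) (hμ : ∀ x y, g (dd x n q) (dd y n q) = μ * g (dd x (dd y F) q) (n q))
    {x y w : Fin 2 → ℂ} (hw : dd x (dd y F) q = dd w F q + g (dd x (dd y F) q) (n q) • n q) :
    dd x (dd y n) q = dd w n q - (μ * g (dd x (dd y F) q) (n q)) • n q := by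
  rw [← sub_eq_zero]
  refine h.eq_zero hq (fun z => ?_) ?_
  · rw [g_sub_left, g_sub_left, g_smul_left, h.g_second_normal_dd hpar hq, g_comm (dd w n q),
      h.g_dd_dd_normal_comm hq z w, g_comm (n q), h.g_dd_normal hq]
    conv_lhs => rw [hw]
    rw [g_add_left, g_smul_left, g_comm (n q) (dd z n q), h.g_dd_normal_normal hq]
    ring
  · rw [g_sub_left, g_sub_left, g_smul_left, h.g_second_normal hq, h.g_dd_normal_normal hq,
      h.unit q hq, g_comm (dd y n q), hμ]
    ring

end Proportional

end IsUnitNormalOn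

/-! ### The unit normal is an affine function of the position -/

theorem eq_of_dd_eq_zero {W : Type*} [NormedAddCommGroup W] [NormedSpace ℂ W]
    {u : (Fin 2 → ℂ) → W} {c : Fin 2 → ℂ} {r : ℝ}
    (hu : DifferentiableOn ℂ u (Metric.ball c r))
    (h : ∀ q ∈ Metric.ball c r, ∀ x, dd x u q = 0) {p q : Fin 2 → ℂ}
    (hp : p ∈ Metric.ball c r) (hq : q ∈ Metric.ball c r) : u p = u q :=
  Metric.isOpen_ball.is_const_of_fderiv_eq_zero (convex_ball c r).isPreconnected hu
    (fun s hs => ContinuousLinearMap.ext fun x => h s hs x) hp hq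

theorem dd_clm (C : (Fin 3 → ℂ) →L[ℂ] Fin 3 → ℂ) {u : (Fin 2 → ℂ) → Fin 3 → ℂ}
    {q : Fin 2 → ℂ} (hu : DifferentiableAt ℂ u q) (x : Fin 2 → ℂ) :
    dd x (fun r => C (u r)) q = C (dd x u q) :=
  congrArg (fun T => T x) (C.hasFDerivAt.comp q hu.hasFDerivAt).fderiv

namespace IsUnitNormalOn

variable {F n : (Fin 2 → ℂ) → Fin 3 → ℂ} {U : Set (Fin 2 → ℂ)} {q : Fin 2 → ℂ}

/-- The ratio `μ` of the third and the second fundamental form is constant near a point at which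
the second fundamental form does not vanish. -/
theorem exists_proportional (h : IsUnitNormalOn F n U) (hpar : IsParallelOn F n U)
    {q₀ x₀ : Fin 2 → ℂ} (hq₀ : q₀ ∈ U) (hx₀ : dd x₀ n q₀ ≠ 0) :
    ∃ r > 0, Metric.ball q₀ r ⊆ U ∧ ∃ μ : ℂ, ∀ q ∈ Metric.ball q₀ r, ∀ x y,
      g (dd x n q) (dd y n q) = μ * g (dd x (dd y F) q) (n q) := by
  obtain ⟨y₀, hy₀⟩ : ∃ y, g (dd x₀ (dd y F) q₀) (n q₀) ≠ 0 := by
    by_contra! hcon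
    refine hx₀ (h.eq_zero hq₀ (fun y => ?_) (h.g_dd_normal_normal hq₀ x₀))
    rw [g_comm, ← neg_eq_zero, ← h.g_second hq₀]
    exact hcon y
  set β : (Fin 2 → ℂ) → ℂ := fun r => g (dd x₀ (dd y₀ F) r) (n r) with hβ
  set γ : (Fin 2 → ℂ) → ℂ := fun r => g (dd x₀ n r) (dd y₀ n r) with hγ
  have aβ : ∀ q ∈ U, AnalyticAt ℂ β q := fun q hq => analyticAt_g
    (analyticAt_dd (analyticAt_dd (h.analytic q hq) y₀) x₀) (h.analytic_normal q hq)
  have aγ : ∀ q ∈ U, AnalyticAt ℂ γ q := fun q hq => analyticAt_g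
    (analyticAt_dd (h.analytic_normal q hq) x₀) (analyticAt_dd (h.analytic_normal q hq) y₀)
  have hev : ∀ᶠ q in nhds q₀, q ∈ U ∧ β q ≠ 0 :=
    Filter.Eventually.and (h.isOpen.mem_nhds hq₀) ((aβ q₀ hq₀).continuousAt.eventually_ne hy₀)
  obtain ⟨r, hr, hball⟩ := Metric.eventually_nhds_iff_ball.1 hev
  have hprop : ∀ q ∈ Metric.ball q₀ r, ∀ x y, g (dd x n q) (dd y n q) =
      (γ q / β q) * g (dd x (dd y F) q) (n q) := by
    intro q hq x y
    rw [div_mul_eq_mul_div, eq_div_iff (hball q hq).2]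
    linear_combination h.second_mul_third hpar (hball q hq).1 x₀ y₀ x y
  have hdiff : ∀ q ∈ Metric.ball q₀ r, DifferentiableAt ℂ (fun q => γ q / β q) q := fun q hq =>
    ((aγ q (hball q hq).1).div (aβ q (hball q hq).1) (hball q hq).2).differentiableAt
  have hconst : ∀ q ∈ Metric.ball q₀ r, γ q / β q = γ q₀ / β q₀ := by
    intro q hq
    refine eq_of_dd_eq_zero (u := fun q => γ q / β q)
      (fun q hq => (hdiff q hq).differentiableWithinAt) (fun q hq y => ?_) hq
      (Metric.mem_ball_self hr)
    have hqU := (hball q hq).1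
    -- `∇h = 0` makes both forms parallel, so the derivative falls on their ratio only
    have e1 : γ =ᶠ[nhds q] fun r => (γ r / β r) • β r := by
      filter_upwards [Metric.isOpen_ball.mem_nhds hq] with s hs
      rw [smul_eq_mul, div_mul_cancel₀ _ (hball s hs).2]
    have e2 := dd_congr e1 y
    rw [dd_smul (hdiff q hq) (aβ q hqU).differentiableAt,
      h.dd_third hpar hqU (hprop q hq) x₀ y y₀] at e2
    have e3 : dd y (fun q => γ q / β q) q * β q = 0 := by
      simp only [smul_eq_mul] at e2
      linear_combination -e2
    exact (mul_eq_zero.1 e3).resolve_right (hball q hq).2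
  exact ⟨r, hr, fun q hq => (hball q hq).1, γ q₀ / β q₀, fun q hq x y => by
    rw [← hconst q hq]; exact hprop q hq x y⟩

/-- The differential of `F` completed by the normal to an isomorphism `ℂ² × ℂ → ℂ³`. -/
noncomputable def frame (F n : (Fin 2 → ℂ) → Fin 3 → ℂ) (q : Fin 2 → ℂ) :
    (Fin 2 → ℂ) × ℂ →L[ℂ] Fin 3 → ℂ :=
  (fderiv ℂ F q).coprod (ContinuousLinearMap.toSpanSingleton ℂ (n q))

theorem frame_apply (x : Fin 2 → ℂ) (t : ℂ) : frame F n q (x, t) = dd x F q + t • n q := by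
  simp [frame, dd]

theorem isInvertible_frame (h : IsUnitNormalOn F n U) (hq : q ∈ U) :
    (frame F n q).IsInvertible := by
  have hsurj : Function.Surjective (frame F n q) := by
    intro v
    obtain ⟨x, hx⟩ := h.exists_eq_add hq v
    exact ⟨(x, g v (n q)), by rw [frame_apply, ← hx]⟩
  have hinj : Function.Injective (frame F n q) :=
    (LinearMap.injective_iff_surjective_of_finrank_eq_finrank (f := (frame F n q).toLinearMap)
      (by simp)).2 hsurj
  exact ⟨(LinearEquiv.ofBijective (frame F n q).toLinearMap
    ⟨hinj, hsurj⟩).toContinuousLinearEquiv, rfl⟩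

/-- The linear map of `ℂ³` that sends `∂ₓF` to `-∂ₓn` and `n` to `μ n`, that is, the shape operator
extended by `μ` on the normal line. -/
noncomputable def extendedShape (F n : (Fin 2 → ℂ) → Fin 3 → ℂ) (μ : ℂ) (q : Fin 2 → ℂ) :
    (Fin 3 → ℂ) →L[ℂ] Fin 3 → ℂ :=
  ((-fderiv ℂ n q).coprod (ContinuousLinearMap.toSpanSingleton ℂ (μ • n q))) ∘L
    (frame F n q).inverse

theorem extendedShape_dd (h : IsUnitNormalOn F n U) (hq : q ∈ U) (μ : ℂ) (x : Fin 2 → ℂ) :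
    extendedShape F n μ q (dd x F q) = -dd x n q := by
  have h1 : dd x F q = frame F n q (x, 0) := by rw [frame_apply]; simp
  rw [h1, extendedShape, ContinuousLinearMap.comp_apply,
    (h.isInvertible_frame hq).inverse_apply_eq.2 rfl]
  simp [dd]

theorem extendedShape_normal (h : IsUnitNormalOn F n U) (hq : q ∈ U) (μ : ℂ) :
    extendedShape F n μ q (n q) = μ • n q := by
  have h1 : n q = frame F n q (0, 1) := by rw [frame_apply]; simp [dd]
  conv_lhs => rw [h1]
  rw [extendedShape, ContinuousLinearMap.comp_apply,
    (h.isInvertible_frame hq).inverse_apply_eq.2 rfl]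
  simp

theorem differentiableAt_extendedShape (h : IsUnitNormalOn F n U) (hq : q ∈ U) (μ : ℂ) :
    DifferentiableAt ℂ (extendedShape F n μ) q := by
  have aF := (h.analytic q hq).fderiv.differentiableAt
  have an := (h.analytic_normal q hq).fderiv.differentiableAt
  have an' := (h.analytic_normal q hq).differentiableAt
  have hcop : ∀ {A : (Fin 2 → ℂ) → (Fin 2 → ℂ) →L[ℂ] Fin 3 → ℂ} {v : (Fin 2 → ℂ) → Fin 3 → ℂ},
      DifferentiableAt ℂ A q → DifferentiableAt ℂ v q → DifferentiableAt ℂ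
      (fun q => (A q).coprod (ContinuousLinearMap.toSpanSingleton ℂ (v q))) q := by
    intro A v hA hv
    exact (ContinuousLinearMap.coprodEquivL (𝕜 := ℂ) (S := ℂ) (E := Fin 2 → ℂ) (F := ℂ)
      (G := Fin 3 → ℂ)).differentiableAt.comp q (hA.prodMk
        ((ContinuousLinearMap.toSpanSingletonCLE (𝕜 := ℂ) (E := Fin 3 → ℂ)).differentiableAt.comp
          q hv))
  have hfr : DifferentiableAt ℂ (frame F n) q := hcop aF an'
  have hinv : DifferentiableAt ℂ (fun q => (frame F n q).inverse) q := by
    have := ((h.isInvertible_frame hq).contDiffAt_map_inverse (n := 1)).differentiableAt one_ne_zero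
    exact this.comp q hfr
  exact (hcop an.neg (an'.const_smul μ)).clm_comp hinv

theorem dd_extendedShape (h : IsUnitNormalOn F n U) (hpar : IsParallelOn F n U) {μ : ℂ}
    (hU : ∀ q ∈ U, ∀ x y, g (dd x n q) (dd y n q) = μ * g (dd x (dd y F) q) (n q)) (hq : q ∈ U)
    (y : Fin 2 → ℂ) : dd y (extendedShape F n μ) q = 0 := by
  have hμ := hU q hq
  have aF := h.analytic q hq
  have an := h.analytic_normal q hq
  set C := extendedShape F n μ with hC
  have hdC := h.differentiableAt_extendedShape hq μ
  have hprod : ∀ {u : (Fin 2 → ℂ) → Fin 3 → ℂ}, DifferentiableAt ℂ u q →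
      dd y (fun r => C r (u r)) q = dd y C q (u q) + C q (dd y u q) := by
    intro u hu
    simp only [dd]
    rw [(hdC.hasFDerivAt.clm_apply hu.hasFDerivAt).fderiv]
    simp [add_comm, hC]
  have hneg : ∀ x, dd y (fun r => -dd x n r) q = -dd y (dd x n) q := by
    intro x
    simp only [dd_apply y, fderiv_fun_neg, neg_apply]
  have h1 : ∀ x, dd y C q (dd x F q) = 0 := by
    intro x
    have e1 : (fun r => C r (dd x F r)) =ᶠ[nhds q] fun r => -dd x n r := by
      filter_upwards [h.isOpen.mem_nhds hq] with r hr using h.extendedShape_dd hr μ x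
    have e2 := dd_congr e1 y
    obtain ⟨w, hw⟩ := h.exists_eq_add hq (dd y (dd x F) q)
    rw [hprod (analyticAt_dd aF x).differentiableAt, hneg,
      h.dd_dd_normal_of_proportional hpar hq hμ hw, hw, map_add, map_smul,
      h.extendedShape_dd hq, h.extendedShape_normal hq, ← hw, smul_smul, mul_comm _ μ] at e2
    have e3 := eq_sub_of_add_eq e2
    rw [e3]
    abel
  have h2 : dd y C q (n q) = 0 := by
    have e1 : (fun r => C r (n r)) =ᶠ[nhds q] fun r => μ • n r := by
      filter_upwards [h.isOpen.mem_nhds hq] with r hr using h.extendedShape_normal hr μ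
    have e2 := dd_congr e1 y
    obtain ⟨w, hw⟩ := h.exists_dd_normal_eq hq y
    have e4 : dd y (fun r => μ • n r) q = μ • dd y n q := by
      simp only [dd]
      rw [fderiv_fun_const_smul an.differentiableAt]
      rfl
    rw [hprod an.differentiableAt, e4, hw, h.extendedShape_dd hq,
      h.dd_normal_of_proportional hq hμ hw, neg_smul, neg_neg] at e2
    exact add_eq_right.1 e2
  ext1 v
  obtain ⟨x, hx⟩ := h.exists_eq_add hq v
  rw [hx, map_add, map_smul, h1, h2]
  simp

/-- For a parallel surface there is a constant linear map `C` of `ℂ³` with `dn = -C ∘ dF` and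
`C n = μ n`, locally. Unless `C` vanishes, it does not vanish on the tangent plane. -/
theorem exists_linear (h : IsUnitNormalOn F n U) (hpar : IsParallelOn F n U) (hne : U.Nonempty) :
    ∃ q₀ ∈ U, ∃ r > 0, Metric.ball q₀ r ⊆ U ∧ ∃ (C : (Fin 3 → ℂ) →L[ℂ] Fin 3 → ℂ) (μ : ℂ),
      (∀ q ∈ Metric.ball q₀ r, ∀ x, C (dd x F q) = -dd x n q) ∧
      (∀ q ∈ Metric.ball q₀ r, C (n q) = μ • n q) ∧
      (C = 0 ∧ μ = 0 ∨ ∃ x, C (dd x F q₀) ≠ 0) := by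
  by_cases hall : ∀ q ∈ U, ∀ x, dd x n q = 0
  · obtain ⟨q₀, hq₀⟩ := hne
    obtain ⟨r, hr, hball⟩ := Metric.isOpen_iff.1 h.isOpen q₀ hq₀
    refine ⟨q₀, hq₀, r, hr, hball, 0, 0, fun q hq x => ?_, fun q hq => ?_, Or.inl ⟨rfl, rfl⟩⟩
    · rw [hall q (hball hq) x]; simp
    · simp
  · push Not at hall
    obtain ⟨q₀, hq₀, x₀, hx₀⟩ := hall
    obtain ⟨r, hr, hball, μ, hμ⟩ := h.exists_proportional hpar hq₀ hx₀
    have hV := h.mono Metric.isOpen_ball hball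
    have hparV : IsParallelOn F n (Metric.ball q₀ r) := fun q hq => hpar q (hball hq)
    have hconst : ∀ q ∈ Metric.ball q₀ r, extendedShape F n μ q₀ = extendedShape F n μ q :=
      fun q hq => eq_of_dd_eq_zero
        (fun q hq => (hV.differentiableAt_extendedShape hq μ).differentiableWithinAt)
        (fun q hq y => hV.dd_extendedShape hparV hμ hq y) (Metric.mem_ball_self hr) hq
    refine ⟨q₀, hq₀, r, hr, hball, extendedShape F n μ q₀, μ, fun q hq x => ?_, fun q hq => ?_,
      Or.inr ⟨x₀, ?_⟩⟩
    · rw [hconst q hq, hV.extendedShape_dd hq]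
    · rw [hconst q hq, hV.extendedShape_normal hq]
    · rw [h.extendedShape_dd hq₀]
      exact neg_ne_zero.2 hx₀

end IsUnitNormalOn

/-! ### The quadric -/

/-- A quadric through the point `z₀` with unit normal `n₀` there, whose quadratic part is given by
the symmetric matrix `C` of a parallel surface. It is a plane, or `C` does not vanish on the tangent
plane at `z₀`. -/
structure ParallelQuadric where
  C : (Fin 3 → ℂ) →L[ℂ] Fin 3 → ℂ
  μ : ℂ
  z₀ : Fin 3 → ℂ
  n₀ : Fin 3 → ℂ
  unit : g n₀ n₀ = 1
  normal : C n₀ = μ • n₀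
  symm : ∀ v w, g (C v) w = g v (C w)
  sq : ∀ v, C (C v) = μ • C v
  dichotomy : C = 0 ∧ μ = 0 ∨ ∃ v, g v n₀ = 0 ∧ C v ≠ 0

namespace ParallelQuadric

/-- The quadratic polynomial that defines the quadric. -/
noncomputable def poly (Q : ParallelQuadric) (z : Fin 3 → ℂ) : ℂ :=
  2 * g (z - Q.z₀) Q.n₀ - g (z - Q.z₀) (Q.C (z - Q.z₀))

/-- The zero set of the polynomial. -/
def carrier (Q : ParallelQuadric) : Set (Fin 3 → ℂ) := {z | Q.poly z = 0}

end ParallelQuadric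

/-- A parallel surface lies locally in a quadric: with `n = n₀ - C (F - z₀)` the differential of the
polynomial `2 g(z - z₀, n₀) - g(z - z₀, C (z - z₀))` vanishes along the surface. -/
theorem IsUnitNormalOn.exists_parallelQuadric {F n : (Fin 2 → ℂ) → Fin 3 → ℂ}
    {U : Set (Fin 2 → ℂ)} (h : IsUnitNormalOn F n U) (hpar : IsParallelOn F n U)
    (hne : U.Nonempty) :
    ∃ Q : ParallelQuadric, ∃ q₀ ∈ U, ∀ᶠ q in nhds q₀, Q.poly (F q) = 0 := by
  obtain ⟨q₀, hq₀, r, hr, hball, C, μ, hCF, hCn, hdich⟩ := h.exists_linear hpar hne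
  have hV := h.mono Metric.isOpen_ball hball
  have hmem := Metric.mem_ball_self (x := q₀) hr
  have hsymm : ∀ v w, g (C v) w = g v (C w) := by
    intro v w
    obtain ⟨x, hx⟩ := h.exists_eq_add hq₀ v
    obtain ⟨y, hy⟩ := h.exists_eq_add hq₀ w
    generalize g v (n q₀) = s at hx
    generalize g w (n q₀) = t at hy
    subst hx hy
    simp only [map_add, map_smul, hCF q₀ hmem, hCn q₀ hmem, g_add_left, g_add_right, g_smul_left,
      g_smul_right, g_neg_left, g_neg_right, h.g_dd_normal_normal hq₀, h.g_dd_normal hq₀,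
      g_comm (n q₀) (dd _ _ _), g_comm (dd x n q₀), h.g_dd_dd_normal_comm hq₀ y x]
    ring
  have hCC : ∀ x, C (C (dd x F q₀)) = μ • C (dd x F q₀) := by
    intro x
    have an := (h.analytic_normal q₀ hq₀).differentiableAt
    have e1 : (fun r => C (n r)) =ᶠ[nhds q₀] fun r => μ • n r := by
      filter_upwards [Metric.isOpen_ball.mem_nhds hmem] with s hs using hCn s hs
    have e2 := dd_congr e1 x
    have e4 : dd x (fun r => μ • n r) q₀ = μ • dd x n q₀ := by
      simp only [dd]
      rw [fderiv_fun_const_smul an]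
      rfl
    rw [hCF q₀ hmem, map_neg, ← dd_clm C an, e2, e4, smul_neg]
  have hsq : ∀ v, C (C v) = μ • C v := by
    intro v
    obtain ⟨x, hx⟩ := h.exists_eq_add hq₀ v
    rw [hx]
    simp only [map_add, map_smul, hCC, hCn q₀ hmem, smul_add]
    rw [smul_comm μ (g v (n q₀))]
  -- the normal is an affine function of the position
  have haff : ∀ q ∈ Metric.ball q₀ r, n q = n q₀ - C (F q - F q₀) := by
    intro q hq
    have hd : ∀ q ∈ Metric.ball q₀ r, HasFDerivAt (fun s => n s + C (F s))
        (fderiv ℂ n q + C ∘L fderiv ℂ F q) q := fun q hq =>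
      (hV.analytic_normal q hq).differentiableAt.hasFDerivAt.add
        (C.hasFDerivAt.comp q (hV.analytic q hq).differentiableAt.hasFDerivAt)
    have e := eq_of_dd_eq_zero (u := fun s => n s + C (F s))
      (fun q hq => (hd q hq).differentiableAt.differentiableWithinAt) (fun q hq x => ?_) hq hmem
    · rw [map_sub]
      exact (eq_sub_of_add_eq e).trans (by abel)
    · rw [dd, (hd q hq).fderiv]
      have := hCF q hq x
      simp only [dd] at this
      simp [this]
  let Q : ParallelQuadric :=
    { C := C, μ := μ, z₀ := F q₀, n₀ := n q₀, unit := h.unit q₀ hq₀, normal := hCn q₀ hmem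
      symm := hsymm, sq := hsq
      dichotomy := hdich.imp_right fun ⟨x, hx⟩ => ⟨_, h.g_dd_normal hq₀ x, hx⟩ }
  refine ⟨Q, q₀, hq₀, ?_⟩
  have hpoly : ∀ q, Q.poly (F q) =
      g (F q - F q₀) ((2 : ℂ) • n q₀ - C (F q - F q₀)) := fun q => by
    rw [g_sub_right, g_smul_right]; rfl
  have hd : ∀ q ∈ Metric.ball q₀ r, DifferentiableAt ℂ (fun s => F s - F q₀) q :=
    fun q hq => (hV.analytic q hq).differentiableAt.sub_const _
  have hd' : ∀ q ∈ Metric.ball q₀ r,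
      DifferentiableAt ℂ (fun s => (2 : ℂ) • n q₀ - C (F s - F q₀)) q :=
    fun q hq => (C.differentiableAt.comp q (hd q hq)).const_sub _
  filter_upwards [Metric.isOpen_ball.mem_nhds hmem] with q hq
  have e := eq_of_dd_eq_zero (u := fun s => Q.poly (F s)) (fun q hq => ?_) (fun q hq x => ?_) hq hmem
  · rw [e, hpoly, sub_self, g_zero_left]
  · simp only [hpoly]
    exact (gL.hasFDerivAt_of_bilinear (hd q hq).hasFDerivAt
      (hd' q hq).hasFDerivAt).differentiableAt.differentiableWithinAt
  · have e1 : dd x (fun s => F s - F q₀) q = dd x F q := by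
      simp only [dd, fderiv_sub_const]
    have e2 : dd x (fun s => (2 : ℂ) • n q₀ - C (F s - F q₀)) q = -C (dd x F q) := by
      rw [← e1, ← dd_clm C (hd q hq)]
      simp only [dd_apply x, fderiv_const_sub, neg_apply]
    simp only [hpoly]
    rw [dd_g (hd q hq) (hd' q hq), e1, e2]
    have h1 := hV.g_dd_normal hq x
    rw [haff q hq, g_sub_right] at h1
    rw [g_neg_right, ← hsymm, g_sub_right, g_smul_right, g_comm (C _)]
    have h2 := hsymm (F q - F q₀) (dd x F q)
    rw [g_comm, g_comm _ (C _)] at h2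
    linear_combination 2 * h1

/-! ### Normal forms of the quadrics -/

/-- `e₁, e₂, e₃` is an orthonormal basis of `ℂ³` for the bilinear form `g`. -/
structure IsOrthonormalFrame (e₁ e₂ e₃ : Fin 3 → ℂ) : Prop where
  h11 : g e₁ e₁ = 1
  h22 : g e₂ e₂ = 1
  h33 : g e₃ e₃ = 1
  h12 : g e₁ e₂ = 0
  h13 : g e₁ e₃ = 0
  h23 : g e₂ e₃ = 0

theorem exists_sq_eq (c : ℂ) : ∃ s : ℂ, s ^ 2 = c :=
  IsAlgClosed.exists_pow_nat_eq c two_pos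

/-- A unit vector is the last vector of an orthonormal frame. -/
theorem exists_isOrthonormalFrame {n : Fin 3 → ℂ} (hn : g n n = 1) :
    ∃ e₁ e₂, IsOrthonormalFrame e₁ e₂ n := by
  have hg : ∀ v w : Fin 3 → ℂ, g v w = v 0 * w 0 + v 1 * w 1 + v 2 * w 2 := fun v w => by
    simp [g, dotProduct, Fin.sum_univ_three]
  -- one of the vectors `n × εᵢ` is not null, as the sum of their squares is `2 g(n, n)`
  obtain ⟨v, hv, hvn⟩ : ∃ v, g v v ≠ 0 ∧ g v n = 0 := by
    by_contra! hcon
    have key : ∀ v, g v n = 0 → g v v = 0 := fun v hv => by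
      by_contra h
      exact hcon v h hv
    have h1 := key ![n 1, -n 0, 0] (by simp [hg]; ring)
    have h2 := key ![0, n 2, -n 1] (by simp [hg]; ring)
    have h3 := key ![n 2, 0, -n 0] (by simp [hg]; ring)
    simp [hg] at h1 h2 h3 hn
    have : (2 : ℂ) = 0 := by linear_combination h1 + h2 + h3 - 2 * hn
    exact two_ne_zero this
  obtain ⟨s, hs⟩ := exists_sq_eq (g v v)
  have hs0 : s ≠ 0 := by
    rintro rfl
    exact hv (by rw [← hs]; simp)
  obtain ⟨e, he, hen⟩ : ∃ e, g e e = 1 ∧ g e n = 0 := by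
    refine ⟨s⁻¹ • v, ?_, ?_⟩
    · rw [g_smul_left, g_smul_right, ← hs]
      field_simp
    · rw [g_smul_left, hvn, mul_zero]
  refine ⟨e, ![n 1 * e 2 - n 2 * e 1, n 2 * e 0 - n 0 * e 2, n 0 * e 1 - n 1 * e 0],
    he, ?_, hn, ?_, hen, ?_⟩
  · rw [hg] at he hen hn
    simp only [hg, Matrix.cons_val_zero, Matrix.cons_val_one, Matrix.cons_val]
    linear_combination (e 0 * e 0 + e 1 * e 1 + e 2 * e 2) * hn + he
      - (e 0 * n 0 + e 1 * n 1 + e 2 * n 2) * hen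
  · simp only [hg, Matrix.cons_val_zero, Matrix.cons_val_one, Matrix.cons_val]
    ring
  · simp only [hg, Matrix.cons_val_zero, Matrix.cons_val_one, Matrix.cons_val]
    ring

namespace IsOrthonormalFrame

variable {e₁ e₂ e₃ : Fin 3 → ℂ}

theorem mul_transpose (h : IsOrthonormalFrame e₁ e₂ e₃) :
    (Matrix.of ![e₁, e₂, e₃]) * (Matrix.of ![e₁, e₂, e₃]).transpose = 1 := by
  ext i j
  change g (![e₁, e₂, e₃] i) (![e₁, e₂, e₃] j) = _
  fin_cases i <;> fin_cases j <;>
    simp [h.h11, h.h22, h.h33, h.h12, h.h13, h.h23, g_comm e₂ e₁, g_comm e₃ e₁, g_comm e₃ e₂]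

theorem eq_sum (h : IsOrthonormalFrame e₁ e₂ e₃) (w : Fin 3 → ℂ) :
    w = g e₁ w • e₁ + g e₂ w • e₂ + g e₃ w • e₃ := by
  have h1 : (Matrix.of ![e₁, e₂, e₃]).transpose.mulVec ((Matrix.of ![e₁, e₂, e₃]).mulVec w) = w := by
    rw [Matrix.mulVec_mulVec, mul_eq_one_comm.1 h.mul_transpose, Matrix.one_mulVec]
  conv_lhs => rw [← h1]
  ext i
  simp only [Matrix.mulVec, dotProduct, Fin.sum_univ_three, Matrix.transpose_apply, Matrix.of_apply,
    Pi.add_apply, Pi.smul_apply, smul_eq_mul, g, Matrix.cons_val_zero, Matrix.cons_val_one,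
    Matrix.cons_val]
  ring

/-- Coordinates with respect to an orthonormal frame, scaled and translated, are a similarity. -/
theorem isSimilarity (h : IsOrthonormalFrame e₁ e₂ e₃) {α : ℂ} (hα : α ≠ 0)
    (z₀ b : Fin 3 → ℂ) : IsSimilarity fun z =>
      α • ![g e₁ (z - z₀), g e₂ (z - z₀), g e₃ (z - z₀)] + b := by
  refine ⟨α, Matrix.of ![e₁, e₂, e₃], b - α • (Matrix.of ![e₁, e₂, e₃]).mulVec z₀, hα,
    mul_eq_one_comm.1 h.mul_transpose, fun z => ?_⟩
  have : ![g e₁ (z - z₀), g e₂ (z - z₀), g e₃ (z - z₀)] =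
      (Matrix.of ![e₁, e₂, e₃]).mulVec (z - z₀) := by
    ext i
    fin_cases i <;> rfl
  beta_reduce
  rw [this, Matrix.mulVec_sub, smul_sub]
  abel

/-- A rotation of the first two vectors of a frame. -/
theorem rotate (h : IsOrthonormalFrame e₁ e₂ e₃) {σ τ : ℂ} (hστ : σ ^ 2 + τ ^ 2 = 1) :
    IsOrthonormalFrame (σ • e₁ + τ • e₂) (-τ • e₁ + σ • e₂) e₃ := by
  refine ⟨?_, ?_, h.h33, ?_, ?_, ?_⟩ <;>
    simp only [g_add_left, g_add_right, g_smul_left, g_smul_right, h.h11, h.h22, h.h12,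
      h.h13, h.h23, g_comm e₂ e₁]
  · linear_combination hστ
  · linear_combination hστ
  all_goals ring

theorem neg_second (h : IsOrthonormalFrame e₁ e₂ e₃) : IsOrthonormalFrame e₁ (-e₂) e₃ := by
  constructor <;>
    simp only [g_neg_left, g_neg_right, h.h11, h.h22, h.h33, h.h12, h.h13, h.h23, neg_neg, neg_zero]

theorem swap (h : IsOrthonormalFrame e₁ e₂ e₃) : IsOrthonormalFrame e₁ e₃ e₂ :=
  ⟨h.h11, h.h33, h.h22, h.h13, h.h12, by rw [g_comm, h.h23]⟩

end IsOrthonormalFrame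

namespace ParallelQuadric

/-- The polynomial of the quadric in the coordinates of an orthonormal frame that ends with the
normal at the base point. The coefficients `p, t, r` are the entries of the matrix `T` of `C` on the
tangent plane, and the quadratic relations between them say that `T² = μ T`. -/
theorem poly_eq (Q : ParallelQuadric) {e₁ e₂ : Fin 3 → ℂ} (h : IsOrthonormalFrame e₁ e₂ Q.n₀) :
    ∃ p t r : ℂ, p ^ 2 + t ^ 2 = Q.μ * p ∧ t * (p + r) = Q.μ * t ∧ t ^ 2 + r ^ 2 = Q.μ * r ∧
      (p = 0 → t = 0 → r = 0 → Q.C = 0 ∧ Q.μ = 0) ∧ ∀ z, Q.poly z =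
        2 * g Q.n₀ (z - Q.z₀) - (p * g e₁ (z - Q.z₀) ^ 2
          + 2 * t * (g e₁ (z - Q.z₀) * g e₂ (z - Q.z₀)) + r * g e₂ (z - Q.z₀) ^ 2
          + Q.μ * g Q.n₀ (z - Q.z₀) ^ 2) := by
  have hC : ∀ v, g v Q.n₀ = 0 → g Q.n₀ (Q.C v) = 0 := fun v hv => by
    rw [← Q.symm, Q.normal, g_smul_left, g_comm, hv, mul_zero]
  have h1 := h.eq_sum (Q.C e₁)
  have h2 := h.eq_sum (Q.C e₂)
  rw [hC _ h.h13, zero_smul, add_zero] at h1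
  rw [hC _ h.h23, zero_smul, add_zero] at h2
  rw [g_comm e₂, Q.symm] at h1
  generalize g e₁ (Q.C e₁) = p at h1
  generalize g e₁ (Q.C e₂) = t at h1 h2
  generalize g e₂ (Q.C e₂) = r at h2
  have k : ∀ a b c d : ℂ, a • e₁ + b • e₂ = c • e₁ + d • e₂ → a = c ∧ b = d := by
    intro a b c d e
    have e1 := congrArg (g e₁) e
    have e2 := congrArg (g e₂) e
    simp only [g_add_right, g_smul_right, h.h11, h.h22, h.h12, g_comm e₂ e₁] at e1 e2
    exact ⟨by linear_combination e1, by linear_combination e2⟩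
  have s1 := Q.sq e₁
  have s2 := Q.sq e₂
  rw [h1, map_add, map_smul, map_smul, h1, h2] at s1
  rw [h2, map_add, map_smul, map_smul, h1, h2] at s2
  obtain ⟨k1, k2⟩ := k (p * p + t * t) (p * t + t * r) (Q.μ * p) (Q.μ * t)
    (by refine Eq.trans ?_ (s1.trans ?_) <;> module)
  obtain ⟨k3, k4⟩ := k (t * p + r * t) (t * t + r * r) (Q.μ * t) (Q.μ * r)
    (by refine Eq.trans ?_ (s2.trans ?_) <;> module)
  refine ⟨p, t, r, by linear_combination k1, by linear_combination k2, by linear_combination k4,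
    ?_, fun z => ?_⟩
  · rintro rfl rfl rfl
    refine Q.dichotomy.resolve_right ?_
    rintro ⟨v, hv, hCv⟩
    refine hCv ?_
    rw [h.eq_sum v, g_comm Q.n₀, hv, map_add, map_add, map_smul, map_smul, h1, h2]
    simp
  · rw [poly]
    have hw := h.eq_sum (z - Q.z₀)
    rw [g_comm _ Q.n₀]
    generalize z - Q.z₀ = w at hw ⊢
    generalize g e₁ w = a at *
    generalize g e₂ w = b at *
    generalize g Q.n₀ w = s at *
    rw [hw]
    simp only [map_add, map_smul, h1, h2, Q.normal, g_add_left, g_add_right, g_smul_left,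
      g_smul_right, h.h11, h.h22, h.h33, h.h12, h.h13, h.h23, g_comm e₂ e₁, g_comm Q.n₀ e₁,
      g_comm Q.n₀ e₂]
    ring

/-- Each of the quadrics is similar to one of the four model surfaces. -/
theorem exists_isSimilarity (Q : ParallelQuadric) : ∃ φ, IsSimilarity φ ∧
    (Q.carrier = φ ⁻¹' complexPlane ∨ Q.carrier = φ ⁻¹' complexSphere ∨
      Q.carrier = φ ⁻¹' complexCylinder ∨ Q.carrier = φ ⁻¹' surfaceB) := by
  obtain ⟨e₁, e₂, h⟩ := exists_isOrthonormalFrame Q.unit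
  obtain ⟨p, t, r, h1, h2, h3, h0, hpoly⟩ := Q.poly_eq h
  by_cases hz : p = 0 ∧ t = 0 ∧ r = 0
  · obtain ⟨rfl, rfl, rfl⟩ := hz
    obtain ⟨-, hμ⟩ := h0 rfl rfl rfl
    refine ⟨_, h.isSimilarity one_ne_zero Q.z₀ 0, Or.inl ?_⟩
    ext z
    simp [carrier, complexPlane, hpoly, hμ]
  by_cases hμ : Q.μ = 0
  · rw [hμ] at h1 h2 h3
    have ht : t ≠ 0 := by
      rintro rfl
      refine hz ⟨?_, rfl, ?_⟩
      · simpa using h1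
      · simpa using h3
    have hr : r = -p := by
      have : p + r = 0 := by
        refine (mul_eq_zero.1 (h2.trans (zero_mul t))).resolve_left ht
      linear_combination this
    have hp : p ≠ 0 := by
      rintro rfl
      exact ht (by simpa using h1)
    have hp2 : p / 2 ≠ 0 := div_ne_zero hp two_ne_zero
    have hI := Complex.I_sq
    have hcase : t = Complex.I * p ∨ t = -(Complex.I * p) := by
      refine sq_eq_sq_iff_eq_or_eq_neg.1 ?_
      linear_combination h1 - p ^ 2 * hI
    -- the quadratic part is `p (a ± i b)²`; the sign is absorbed by a reflection
    rcases hcase with rfl | rfl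
    · refine ⟨_, h.isSimilarity hp2 Q.z₀ 0, Or.inr (Or.inr (Or.inr ?_))⟩
      ext z
      simp only [carrier, surfaceB, hpoly, hμ, hr, Set.mem_ofPred_eq, Set.mem_preimage]
      generalize g e₁ (z - Q.z₀) = a
      generalize g e₂ (z - Q.z₀) = b
      generalize g Q.n₀ (z - Q.z₀) = s
      simp
      constructor
      · intro e
        linear_combination p / 4 * e - p ^ 2 / 4 * b ^ 2 * hI
      · intro e
        refine mul_left_cancel₀ hp ?_
        linear_combination 4 * e + p ^ 2 * b ^ 2 * hI
    · refine ⟨_, h.neg_second.isSimilarity hp2 Q.z₀ 0, Or.inr (Or.inr (Or.inr ?_))⟩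
      ext z
      simp only [carrier, surfaceB, hpoly, hμ, hr, Set.mem_ofPred_eq, Set.mem_preimage, g_neg_left]
      generalize g e₁ (z - Q.z₀) = a
      generalize g e₂ (z - Q.z₀) = b
      generalize g Q.n₀ (z - Q.z₀) = s
      simp
      constructor
      · intro e
        linear_combination p / 4 * e - p ^ 2 / 4 * b ^ 2 * hI
      · intro e
        refine mul_left_cancel₀ hp ?_
        linear_combination 4 * e + p ^ 2 * b ^ 2 * hI
  by_cases hs : t = 0 ∧ p = Q.μ ∧ r = Q.μ
  · obtain ⟨rfl, hp, hr⟩ := hs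
    refine ⟨_, h.isSimilarity hμ Q.z₀ ![0, 0, -1], Or.inr (Or.inl ?_)⟩
    ext z
    simp only [carrier, complexSphere, hpoly, hp, hr, Set.mem_ofPred_eq, Set.mem_preimage]
    generalize g e₁ (z - Q.z₀) = a
    generalize g e₂ (z - Q.z₀) = b
    generalize g Q.n₀ (z - Q.z₀) = s
    simp
    constructor
    · intro e
      linear_combination -Q.μ * e
    · intro e
      refine mul_left_cancel₀ hμ ?_
      linear_combination -e
  · -- the quadratic part has rank one on the tangent plane and trace `μ`
    have htr : p + r = Q.μ ∧ p * r = t ^ 2 := by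
      by_cases ht : t = 0
      · subst ht
        have hp : p * (p - Q.μ) = 0 := by linear_combination h1
        have hr : r * (r - Q.μ) = 0 := by linear_combination h3
        rcases mul_eq_zero.1 hp with rfl | hp <;> rcases mul_eq_zero.1 hr with rfl | hr
        · exact absurd ⟨rfl, rfl, rfl⟩ hz
        · exact ⟨by linear_combination hr, by ring⟩
        · exact ⟨by linear_combination hp, by ring⟩
        · exact absurd ⟨rfl, sub_eq_zero.1 hp, sub_eq_zero.1 hr⟩ hs
      · have e : p + r = Q.μ := mul_left_cancel₀ ht (h2.trans (mul_comm _ _))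
        exact ⟨e, by linear_combination p * e - h1⟩
    obtain ⟨σ, τ, hσ, hτ, hστ⟩ : ∃ σ τ : ℂ, Q.μ * σ ^ 2 = p ∧ Q.μ * τ ^ 2 = r ∧
        Q.μ * (σ * τ) = t := by
      by_cases hp : p = 0
      · subst hp
        have ht : t = 0 := by simpa using h1
        exact ⟨0, 1, by simp, by linear_combination -htr.1, by simp [ht]⟩
      · obtain ⟨σ, hσ⟩ := exists_sq_eq (p / Q.μ)
        have hσ0 : σ ≠ 0 := by
          rintro rfl
          exact div_ne_zero hp hμ (by rw [← hσ]; simp)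
        have hσ' : Q.μ * σ ^ 2 = p := by rw [hσ]; field_simp
        refine ⟨σ, t / (Q.μ * σ), hσ', ?_, ?_⟩
        · rw [div_pow]
          field_simp
          linear_combination -htr.2 - r * hσ'
        · field_simp
    have hunit : σ ^ 2 + τ ^ 2 = 1 := by
      refine mul_left_cancel₀ hμ ?_
      linear_combination hσ + hτ + htr.1
    refine ⟨_, (h.rotate hunit).swap.isSimilarity hμ Q.z₀ ![0, -1, 0],
      Or.inr (Or.inr (Or.inl ?_))⟩
    ext z
    simp only [carrier, complexCylinder, hpoly, Set.mem_ofPred_eq, Set.mem_preimage, ← hσ, ← hτ,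
      ← hστ, g_add_left, g_smul_left]
    generalize g e₁ (z - Q.z₀) = a
    generalize g e₂ (z - Q.z₀) = b
    generalize g Q.n₀ (z - Q.z₀) = s
    simp
    constructor
    · intro e
      linear_combination -Q.μ * e
    · intro e
      refine mul_left_cancel₀ hμ ?_
      linear_combination -e

/-- A relatively open subset of one of the quadrics is similar to an open part of a model surface. -/
theorem isSimilarToOpenPart (Q : ParallelQuadric) {N O : Set (Fin 3 → ℂ)} (hO : IsOpen O)
    (hN : N = Q.carrier ∩ O) :
    IsSimilarToOpenPart N complexPlane ∨ IsSimilarToOpenPart N complexSphere ∨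
      IsSimilarToOpenPart N complexCylinder ∨ IsSimilarToOpenPart N surfaceB := by
  obtain ⟨φ, hφ, hcases⟩ := Q.exists_isSimilarity
  have key : ∀ S, Q.carrier = φ ⁻¹' S → IsSimilarToOpenPart N S := by
    intro S hS
    refine ⟨φ, hφ, φ '' O, ?_, by rw [hN, hS, Set.image_preimage_inter]⟩
    obtain ⟨α, A, b, hα, hA, hφ⟩ := hφ
    have hA' : A * A.transpose = 1 := mul_eq_one_comm.1 hA
    have himg : φ '' O = (fun y => A.transpose.mulVec (α⁻¹ • (y - b))) ⁻¹' O := by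
      refine congrFun (Set.image_eq_preimage_of_inverse (fun z => ?_) (fun y => ?_)) O
      · simp only [hφ, add_sub_cancel_right]
        rw [smul_smul, inv_mul_cancel₀ hα, one_smul, Matrix.mulVec_mulVec, hA, Matrix.one_mulVec]
      · simp only [hφ]
        rw [Matrix.mulVec_mulVec, hA', Matrix.one_mulVec, smul_smul, mul_inv_cancel₀ hα, one_smul,
          sub_add_cancel]
    rw [himg]
    refine hO.preimage ?_
    fun_prop
  exact hcases.imp (key _) (Or.imp (key _) (Or.imp (key _) (key _)))

end ParallelQuadric

/-! ### From local to global -/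

namespace ParallelQuadric

theorem analyticAt_poly_comp (Q : ParallelQuadric) {F : (Fin 2 → ℂ) → Fin 3 → ℂ} {q : Fin 2 → ℂ}
    (hF : AnalyticAt ℂ F q) : AnalyticAt ℂ (fun s => Q.poly (F s)) q := by
  have h1 : AnalyticAt ℂ (fun s => F s - Q.z₀) q := hF.sub analyticAt_const
  exact (analyticAt_const.mul (analyticAt_g h1 analyticAt_const)).sub
    (analyticAt_g h1 ((Q.C.analyticAt _).comp h1))

/-- The gradient of the polynomial (up to the factor `2`), an affine extension of the unit
normal. -/
noncomputable def grad (Q : ParallelQuadric) (z : Fin 3 → ℂ) : Fin 3 → ℂ := Q.n₀ - Q.C (z - Q.z₀)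

theorem g_grad_grad (Q : ParallelQuadric) (z : Fin 3 → ℂ) :
    g (Q.grad z) (Q.grad z) = 1 - Q.μ * Q.poly z := by
  simp only [grad, poly, g_sub_left, g_sub_right, Q.unit, Q.symm (z - Q.z₀), Q.sq, Q.normal,
    g_smul_right, g_comm Q.n₀ (Q.C _)]
  ring

theorem C_grad (Q : ParallelQuadric) (z : Fin 3 → ℂ) : Q.C (Q.grad z) = Q.μ • Q.grad z := by
  rw [grad, map_sub, Q.normal, Q.sq, smul_sub]

theorem poly_add (Q : ParallelQuadric) (z v : Fin 3 → ℂ) :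
    Q.poly (z + v) = Q.poly z + 2 * g v (Q.grad z) - g v (Q.C v) := by
  have h : z + v - Q.z₀ = (z - Q.z₀) + v := by abel
  rw [poly, poly, grad, h, map_add]
  simp only [g_add_left, g_add_right, g_sub_right, ← Q.symm (z - Q.z₀) v]
  rw [g_comm v (Q.C (z - Q.z₀))]
  ring

/-- An immersed surface in one of the quadrics covers a neighbourhood in the quadric. Indeed
`(x, t) ↦ F x + t n₁`, with `n₁` the unit normal at `F q`, covers a neighbourhood of `F q` in `ℂ³`, and
for small `t ≠ 0` its values lie off the quadric. -/
theorem eventually_mem_image (Q : ParallelQuadric) {F : (Fin 2 → ℂ) → Fin 3 → ℂ} {q : Fin 2 → ℂ}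
    {U : Set (Fin 2 → ℂ)} (hU : U ∈ nhds q) (hF : AnalyticAt ℂ F q)
    (hinj : Function.Injective (fderiv ℂ F q)) (hQ : ∀ s ∈ U, Q.poly (F s) = 0) :
    ∀ᶠ z in nhds (F q), z ∈ Q.carrier → z ∈ F '' U := by
  set n₁ := Q.grad (F q) with hn₁
  have hunit : g n₁ n₁ = 1 := by
    rw [hn₁, g_grad_grad, hQ q (mem_of_mem_nhds hU), mul_zero, sub_zero]
  have horth : ∀ x, g (fderiv ℂ F q x) n₁ = 0 := by
    intro x
    have dF : DifferentiableAt ℂ (fun s => F s - F q) q := hF.differentiableAt.sub_const _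
    have dv : DifferentiableAt ℂ (fun s => (2 : ℂ) • n₁ - Q.C (F s - F q)) q :=
      (Q.C.differentiableAt.comp q dF).const_sub _
    have e1 : (fun s => g (F s - F q) ((2 : ℂ) • n₁ - Q.C (F s - F q))) =ᶠ[nhds q]
        fun _ => 0 := by
      filter_upwards [hU] with s hs
      have := Q.poly_add (F q) (F s - F q)
      rw [add_sub_cancel, hQ s hs, hQ q (mem_of_mem_nhds hU)] at this
      rw [g_sub_right, g_smul_right]
      linear_combination -this
    have e2 := dd_congr e1 x
    have e3 : dd x (fun s => F s - F q) q = fderiv ℂ F q x := by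
      simp only [dd, fderiv_sub_const]
    rw [dd_const, dd_g dF dv, e3, sub_self, map_zero, sub_zero, g_zero_left, g_smul_right] at e2
    simpa using e2
  let G : (Fin 2 → ℂ) × ℂ → Fin 3 → ℂ := fun s => F s.1 + s.2 • n₁
  let G' : (Fin 2 → ℂ) × ℂ →L[ℂ] Fin 3 → ℂ :=
    (fderiv ℂ F q) ∘L ContinuousLinearMap.fst ℂ (Fin 2 → ℂ) ℂ +
      (ContinuousLinearMap.snd ℂ (Fin 2 → ℂ) ℂ).smulRight n₁
  have hG : HasStrictFDerivAt G G' (q, 0) := by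
    refine HasStrictFDerivAt.add ?_ ?_
    · exact HasStrictFDerivAt.comp (q, (0 : ℂ)) (g := F) hF.hasStrictFDerivAt hasStrictFDerivAt_fst
    · exact hasStrictFDerivAt_snd.smul_const n₁
  have hsurj : G'.range = ⊤ := by
    rw [LinearMap.range_eq_top]
    intro v
    obtain ⟨x, hx⟩ := exists_eq_tangent_add_normal hinj hunit horth v
    exact ⟨(x, g v n₁), by rw [hx]; simp [G', g_add_left, g_smul_left, horth, hunit]⟩
  have hGq : G (q, 0) = F q := by simp [G]
  have hmap := hG.map_nhds_eq_of_surj hsurj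
  rw [hGq] at hmap
  have hcont : ContinuousAt (fun s : (Fin 2 → ℂ) × ℂ => 2 * g n₁ (Q.grad (F s.1)) - s.2 * Q.μ)
      (q, 0) := by
    have c1 : ContinuousAt (fun s : (Fin 2 → ℂ) × ℂ => F s.1) (q, 0) :=
      ContinuousAt.comp (g := F) hF.continuousAt continuousAt_fst
    have c2 : ContinuousAt (fun s : (Fin 2 → ℂ) × ℂ => Q.grad (F s.1)) (q, 0) :=
      continuousAt_const.sub (Q.C.continuous.continuousAt.comp (c1.sub continuousAt_const))
    exact (continuousAt_const.mul ((gL n₁).continuous.continuousAt.comp c2)).sub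
      (continuousAt_snd.mul continuousAt_const)
  have hne : ∀ᶠ s in nhds (q, (0 : ℂ)), 2 * g n₁ (Q.grad (F s.1)) - s.2 * Q.μ ≠ 0 := by
    refine hcont.eventually_ne ?_
    simp [← hn₁, hunit]
  have hU' : ∀ᶠ s in nhds (q, (0 : ℂ)), s.1 ∈ U := continuousAt_fst hU
  have himg := Filter.image_mem_map (m := G) (Filter.inter_mem hU' hne)
  rw [hmap] at himg
  filter_upwards [himg]
  rintro _ ⟨⟨x, t⟩, ⟨hx, ht⟩, rfl⟩ hmem
  have h1 : Q.poly (F x + t • n₁) = 0 := hmem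
  rw [poly_add, hQ x hx, map_smul, hn₁, C_grad, ← hn₁] at h1
  simp only [g_smul_left, g_smul_right, hunit] at h1
  have h2 : t * (2 * g n₁ (Q.grad (F x)) - t * Q.μ) = 0 := by linear_combination h1
  have h3 : t = 0 := (mul_eq_zero.1 h2).resolve_right ht
  exact ⟨x, hx, by simp [G, h3]⟩

end ParallelQuadric

/-- Near a point at which the induced metric is non-degenerate there is a holomorphic unit normal:
the cross product of two coordinate vectors, divided by a local square root. -/
theorem exists_isUnitNormalOn {F : (Fin 2 → ℂ) → Fin 3 → ℂ} {U : Set (Fin 2 → ℂ)} (hU : IsOpen U)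
    (hF : AnalyticOnNhd ℂ F U) (hinj : ∀ q ∈ U, Function.Injective (fderiv ℂ F q))
    {q₀ : Fin 2 → ℂ} (hq₀ : q₀ ∈ U)
    (hnd : ∀ x, (∀ y, g (dd x F q₀) (dd y F q₀) = 0) → x = 0) :
    ∃ n V, V ⊆ U ∧ V.Nonempty ∧ IsUnitNormalOn F n V := by
  let N : (Fin 2 → ℂ) → Fin 3 → ℂ := fun q => crossProduct (dd ![1, 0] F q) (dd ![0, 1] F q)
  have hdd : ∀ q (x : Fin 2 → ℂ), dd x F q = x 0 • dd ![1, 0] F q + x 1 • dd ![0, 1] F q := by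
    intro q x
    have : x = x 0 • ![1, 0] + x 1 • ![0, 1] := by
      ext i
      fin_cases i <;> simp
    conv_lhs => rw [this]
    simp only [dd, map_add, map_smul]
  have hN : ∀ q ∈ U, AnalyticAt ℂ N q := fun q hq =>
    ((crossProduct (R := ℂ)).toContinuousBilinearMap.analyticAt_bilinear
      (dd ![1, 0] F q, dd ![0, 1] F q)).comp_of_eq
      ((analyticAt_dd (hF q hq) _).prod (analyticAt_dd (hF q hq) _)) rfl
  have hNo : ∀ q x, g (dd x F q) (N q) = 0 := by
    intro q x
    rw [hdd, g_add_left, g_smul_left, g_smul_left]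
    have h1 : g (dd ![1, 0] F q) (N q) = 0 := dot_self_cross _ _
    have h2 : g (dd ![0, 1] F q) (N q) = 0 := dot_cross_self _ _
    rw [h1, h2]
    ring
  set κ := g (N q₀) (N q₀) with hκ
  -- `g(N, N)` is the Gram determinant
  have hκ0 : κ ≠ 0 := by
    intro h0
    have hgram : κ = g (dd ![1, 0] F q₀) (dd ![1, 0] F q₀) * g (dd ![0, 1] F q₀) (dd ![0, 1] F q₀)
        - g (dd ![1, 0] F q₀) (dd ![0, 1] F q₀) * g (dd ![0, 1] F q₀) (dd ![1, 0] F q₀) :=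
      cross_dot_cross _ _ _ _
    rw [h0, g_comm (dd ![0, 1] F q₀) (dd ![1, 0] F q₀)] at hgram
    have hker : ∀ a b : ℂ,
        a * g (dd ![1, 0] F q₀) (dd ![1, 0] F q₀) + b * g (dd ![1, 0] F q₀) (dd ![0, 1] F q₀) = 0 →
        a * g (dd ![1, 0] F q₀) (dd ![0, 1] F q₀) + b * g (dd ![0, 1] F q₀) (dd ![0, 1] F q₀) = 0 →
        a = 0 ∧ b = 0 := by
      intro a b h1 h2
      have h := hnd ![a, b] fun y => by
        rw [hdd q₀ ![a, b], hdd q₀ y]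
        simp only [g_add_left, g_add_right, g_smul_left, g_smul_right, Matrix.cons_val_zero,
          Matrix.cons_val_one, g_comm (dd ![0, 1] F q₀) (dd ![1, 0] F q₀)]
        linear_combination y 0 * h1 + y 1 * h2
      exact ⟨by simpa using congrFun h 0, by simpa using congrFun h 1⟩
    generalize g (dd ![1, 0] F q₀) (dd ![1, 0] F q₀) = a at hgram hker
    generalize g (dd ![1, 0] F q₀) (dd ![0, 1] F q₀) = b at hgram hker
    generalize g (dd ![0, 1] F q₀) (dd ![0, 1] F q₀) = c at hgram hker
    obtain ⟨hc, hb⟩ := hker c (-b) (by linear_combination -hgram) (by ring)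
    exact one_ne_zero (hker 0 1 (by linear_combination -hb) (by linear_combination hc)).2
  obtain ⟨s, hs⟩ := exists_sq_eq κ⁻¹
  have hNN : ∀ q ∈ U, AnalyticAt ℂ (fun r => g (N r) (N r) / κ) q := fun q hq =>
    (analyticAt_g (hN q hq) (hN q hq)).div analyticAt_const hκ0
  have hslit : ∀ᶠ q in nhds q₀, q ∈ U ∧ g (N q) (N q) / κ ∈ Complex.slitPlane := by
    refine Filter.Eventually.and (hU.mem_nhds hq₀) ((hNN q₀ hq₀).continuousAt ?_)
    refine Complex.isOpen_slitPlane.mem_nhds ?_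
    rw [← hκ, div_self hκ0]
    exact Complex.one_mem_slitPlane
  obtain ⟨r, hr, hball⟩ := Metric.eventually_nhds_iff_ball.1 hslit
  refine ⟨fun q => (s * Complex.exp (-Complex.log (g (N q) (N q) / κ) / 2)) • N q,
    Metric.ball q₀ r, fun q hq => (hball q hq).1, ⟨q₀, Metric.mem_ball_self hr⟩,
    Metric.isOpen_ball, fun q hq => hF q (hball q hq).1, fun q hq => ?_,
    fun q hq => hinj q (hball q hq).1, fun q hq => ?_, fun q hq x => ?_⟩
  · exact (analyticAt_const.mul ((((hNN q (hball q hq).1).clog (hball q hq).2).neg.div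
      analyticAt_const two_ne_zero).cexp)).smul (hN q (hball q hq).1)
  · have h0 := Complex.slitPlane_ne_zero (hball q hq).2
    have hexp : Complex.exp (-Complex.log (g (N q) (N q) / κ) / 2) ^ 2 =
        (g (N q) (N q) / κ)⁻¹ := by
      rw [← Complex.exp_nat_mul]
      conv_rhs => rw [← Complex.exp_log h0, ← Complex.exp_neg]
      congr 1
      push_cast
      ring
    rw [g_smul_left, g_smul_right, ← mul_assoc, ← sq, mul_pow, hexp, hs, inv_div]
    have h1 : g (N q) (N q) ≠ 0 := fun h => h0 (by rw [h, zero_div])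
    field_simp
  · rw [g_smul_right, ← dd_apply, hNo, mul_zero]

section Global

variable {M : Type*} [TopologicalSpace M] [ChartedSpace (Fin 2 → ℂ) M]

/-- The identity theorem on a connected complex manifold. -/
theorem eq_zero_of_eventuallyEq_zero [PreconnectedSpace M] {u : M → ℂ}
    (hu : ∀ p : M, AnalyticOnNhd ℂ (u ∘ (chartAt (Fin 2 → ℂ) p).symm)
      (chartAt (Fin 2 → ℂ) p).target) {p₀ : M} (h₀ : ∀ᶠ p in nhds p₀, u p = 0) (p : M) :
    u p = 0 := by
  have hopen : IsOpen {p | ∀ᶠ q in nhds p, u q = 0} := isOpen_setOfPred_eventually_nhds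
  have hclosed : IsClosed {p | ∀ᶠ q in nhds p, u q = 0} := by
    refine isClosed_of_closure_subset fun p hp => ?_
    set e := chartAt (Fin 2 → ℂ) p with he
    have hpe : p ∈ e.source := mem_chart_source _ p
    obtain ⟨r, hr, hball⟩ := Metric.isOpen_iff.1 e.open_target (e p) (e.map_source hpe)
    have hV : IsOpen (e.source ∩ e ⁻¹' Metric.ball (e p) r) :=
      e.isOpen_inter_preimage Metric.isOpen_ball
    have hpV : p ∈ e.source ∩ e ⁻¹' Metric.ball (e p) r := ⟨hpe, Metric.mem_ball_self hr⟩
    obtain ⟨p', hp'V, hp'⟩ := mem_closure_iff.1 hp _ hV hpV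
    have hz : u ∘ e.symm =ᶠ[nhds (e p')] 0 := by
      have hc := e.continuousAt_symm (e.map_source hp'V.1)
      rw [ContinuousAt, e.left_inv hp'V.1] at hc
      exact hc.eventually hp'
    have hEq := ((hu p).mono hball).eqOn_zero_of_preconnected_of_eventuallyEq_zero
      (convex_ball _ _).isPreconnected hp'V.2 hz
    filter_upwards [hV.mem_nhds hpV] with q hq
    have := hEq hq.2
    rwa [Function.comp, e.left_inv hq.1] at this
  have huniv := IsClopen.eq_univ ⟨hclosed, hopen⟩ ⟨p₀, h₀⟩
  have hp : p ∈ {p | ∀ᶠ q in nhds p, u q = 0} := huniv ▸ Set.mem_univ p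
  exact hp.self_of_nhds

variable [IsManifold 𝓘(ℂ, Fin 2 → ℂ) ω M]

/-- A connected parallel surface lies in one of the quadrics. -/
theorem IsHolRiemImmersion.exists_parallelQuadric [ConnectedSpace M] {f : M → Fin 3 → ℂ}
    (hf : IsHolRiemImmersion f) (hpar : IsParallel f) :
    ∃ Q : ParallelQuadric, ∀ p, Q.poly (f p) = 0 := by
  obtain ⟨p₀⟩ : Nonempty M := inferInstance
  set e := chartAt (Fin 2 → ℂ) p₀ with he
  have hq₀ : e p₀ ∈ e.target := e.map_source (mem_chart_source _ p₀)
  obtain ⟨n, V, hVU, hVne, hn⟩ := exists_isUnitNormalOn e.open_target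
    (hf.analyticOnNhd_inChart p₀) (fun q hq => hf.injective_fderiv_inChart p₀ hq) hq₀
    (fun x hx => hf.nondegenerate_inChart p₀ hq₀ hx)
  obtain ⟨Q, q₁, hq₁, hQ⟩ := hn.exists_parallelQuadric (hpar.isParallelOn p₀ hf hVU hn) hVne
  refine ⟨Q, eq_zero_of_eventuallyEq_zero (p₀ := e.symm q₁) (fun p q hq => ?_) ?_⟩
  · exact Q.analyticAt_poly_comp (hf.analyticOnNhd_inChart p q hq)
  · have hs := e.map_target (hVU hq₁)
    have hc := e.continuousAt hs
    rw [ContinuousAt, e.right_inv (hVU hq₁)] at hc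
    filter_upwards [hc.eventually hQ, e.open_source.mem_nhds hs] with p hp hps
    simpa [inChart, ← he, e.left_inv hps] using hp

/-- An immersed surface in one of the quadrics is relatively open there. -/
theorem IsHolRiemImmersion.exists_range_eq {f : M → Fin 3 → ℂ}
    (hf : IsHolRiemImmersion f) {Q : ParallelQuadric} (hQ : ∀ p, Q.poly (f p) = 0) :
    ∃ O, IsOpen O ∧ Set.range f = Q.carrier ∩ O := by
  refine ⟨interior {z | z ∈ Q.carrier → z ∈ Set.range f}, isOpen_interior,
    Set.Subset.antisymm ?_ fun z hz => interior_subset hz.2 hz.1⟩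
  rintro _ ⟨p, rfl⟩
  refine ⟨hQ p, mem_interior_iff_mem_nhds.2 ?_⟩
  set e := chartAt (Fin 2 → ℂ) p with he
  have hp := mem_chart_source (Fin 2 → ℂ) p
  have hq : e p ∈ e.target := e.map_source hp
  have h := Q.eventually_mem_image (e.open_target.mem_nhds hq) (hf.analyticOnNhd_inChart p _ hq)
    (hf.injective_fderiv_inChart p hq) (fun s _ => hQ _)
  have hfp : inChart f p (e p) = f p := congrArg f (e.left_inv hp)
  rw [hfp] at h
  filter_upwards [h] with z hz hzQ
  obtain ⟨s, -, hs⟩ := hz hzQ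
  exact ⟨_, hs⟩

end Global

end HolRiem


theorem mainTheorem1 {M : Type*} [TopologicalSpace M] [ConnectedSpace M]
    [ChartedSpace (Fin 2 → ℂ) M] [IsManifold 𝓘(ℂ, Fin 2 → ℂ) ω M]
    (f : M → Fin 3 → ℂ) (hf : HolRiem.IsHolRiemImmersion f) (hpar : HolRiem.IsParallel f) :
    HolRiem.IsSimilarToOpenPart (Set.range f) HolRiem.complexPlane ∨
    HolRiem.IsSimilarToOpenPart (Set.range f) HolRiem.complexSphere ∨
    HolRiem.IsSimilarToOpenPart (Set.range f) HolRiem.complexCylinder ∨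
    HolRiem.IsSimilarToOpenPart (Set.range f) HolRiem.surfaceB := by
  obtain ⟨Q, hQ⟩ := hf.exists_parallelQuadric hpar
  obtain ⟨O, hO, hrange⟩ := hf.exists_range_eq hQ
  exact Q.isSimilarToOpenPart hO hrange
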